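/- Let $\bar{\mathcal K}$ be the class of equations $K_f\colon u_{tx}=f(t,x,u)$, where $f$ is a smooth ($C^\infty$) real function on an open set $D\subseteq\mathbb R^3$ with $f_u\ne0$, meaning that $f_u$ does not vanish identically on any nonempty open subset of $D$. A contact transformation on an open set $\Omega\subseteq\mathbb R^5$ with coordinates $(t,x,u,u_t,u_x)$ is a smooth map $\Phi=(T,X,U,U^t,U^x)\colon\Omega\to\mathbb R^5$ with nowhere vanishing Jacobian satisfying $U^t\mathrm D_tT+U^x\mathrm D_tX=\mathrm D_tU$ and $U^t\mathrm D_xT+U^x\mathrm D_xX=\mathrm D_xU$ for all values of $u_{tt},u_{tx},u_{xx}$, where $\mathrm D_t,\mathrm D_x$ are the total derivative operators; a point transformation on an open set $W\subseteq\mathbb R^3$ with coordinates $(t,x,u)$ is a smooth map $\varphi=(T,X,U)\colon W\to\mathbb R^3$ with nowhere vanishing Jacobian. A triple $(f,\Phi,\tilde f)$ is a contact admissible transformation within $\bar{\mathcal K}$ if $K_f,K_{\tilde f}\in\bar{\mathcal K}$, $\Phi$ is a contact transformation on $\Omega$, $(t,x,u)$ lies in the domain of $f$ and $(T,X,U)$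 lies in the domain of $\tilde f$ for every point of $\Omega$, and $\Phi$ maps $K_f$ to $K_{\tilde f}$: at every point of the second-order jet space over $\Omega$ that satisfies $u_{tx}=f(t,x,u)$ and $\mathrm D_tT\,\mathrm D_xX-\mathrm D_xT\,\mathrm D_tX\ne0$, the second-order prolongation of $\Phi$ satisfies $\tilde u_{\tilde t\tilde x}=\tilde f(\tilde t,\tilde x,\tilde u)$. A triple $(f,\varphi,\tilde f)$ with a point transformation $\varphi$ on $W$ is a point admissible transformation within $\bar{\mathcal K}$ if $K_f,K_{\tilde f}\in\bar{\mathcal K}$, $W$ lies in the domain of $f$, $\varphi(W)$ lies in the domain of $\tilde f$, and the first-order prolongation of $\varphi$ (on its whole domain of definition over $W$) maps $K_f$ to $K_{\tilde f}$ in the same sense. Every contact admissible transformation $(f,\Phi,\tilde f)$ within $\bar{\mathcal K}$ is the first-order prolongation of a point admissible transformation within $\bar{\mathcal K}$. That is, every point of $\Omega$ has an open neighbourhood $V\subseteq\Omega$ such that, on $V$, $\Phi$ equals (and there is defined) the first-order prolongation of a point transformation $\varphi$ on the projection $W$ of $V$ to the $(t,x,u)$-space, with $(f,\varphi,\tilde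 f)$ a point admissible transformation within $\bar{\mathcal K}$; and if, for each $(t,x,u)$, the set of $(u_t,u_x)$ with $(t,x,u,u_t,u_x)\in\Omega$ is connected or empty, then the same holds with $V=\Omega$. -/

import Mathlib

open Set
open scoped ContDiff

/-- The space of independent and dependent variables, with coordinates
`0 ↦ t`, `1 ↦ x`, `2 ↦ u`. -/
abbrev J0 : Type := Fin 3 → ℝ

/-- The first-order jet space, with coordinates
`0 ↦ t`, `1 ↦ x`, `2 ↦ u`, `3 ↦ u_t`, `4 ↦ u_x`. -/
abbrev J1 : Type := Fin 5 → ℝ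

/-- The second-order jet space: a first-order jet together with the values of
`u_tt`, `u_tx`, `u_xx`. -/
structure J2 where
  base : J1
  tt : ℝ
  tx : ℝ
  xx : ℝ

/-- The projection `(t, x, u, u_t, u_x) ↦ (t, x, u)`. -/
def proj (q : J1) : J0 := ![q 0, q 1, q 2]

/-- The partial derivative of `g` with respect to the `i`-th coordinate. -/
noncomputable def pd {n : ℕ} (i : Fin n) (g : (Fin n → ℝ) → ℝ) (y : Fin n → ℝ) : ℝ :=
  fderiv ℝ g y (Pi.single i 1)

/-- The total derivative `D_t g = g_t + u_t g_u + u_tt g_{u_t} + u_tx g_{u_x}` of a function on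
the first-order jet space; it is a function on the second-order jet space. -/
noncomputable def totalDt (g : J1 → ℝ) (θ : J2) : ℝ :=
  pd 0 g θ.base + θ.base 3 * pd 2 g θ.base + θ.tt * pd 3 g θ.base + θ.tx * pd 4 g θ.base

/-- The total derivative `D_x g = g_x + u_x g_u + u_tx g_{u_t} + u_xx g_{u_x}` of a function on
the first-order jet space; it is a function on the second-order jet space. -/
noncomputable def totalDx (g : J1 → ℝ) (θ : J2) : ℝ :=
  pd 1 g θ.base + θ.base 4 * pd 2 g θ.base + θ.tx * pd 3 g θ.base + θ.xx * pd 4 g θ.base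

/-- The total derivative `D_t g = g_t + u_t g_u` of a function of `(t, x, u)`; it is a function
on the first-order jet space. -/
noncomputable def totalDt₀ (g : J0 → ℝ) (q : J1) : ℝ :=
  pd 0 g (proj q) + q 3 * pd 2 g (proj q)

/-- The total derivative `D_x g = g_x + u_x g_u` of a function of `(t, x, u)`; it is a function
on the first-order jet space. -/
noncomputable def totalDx₀ (g : J0 → ℝ) (q : J1) : ℝ :=
  pd 1 g (proj q) + q 4 * pd 2 g (proj q)

/-- The class of equations `u_tx = f(t, x, u)` with `f_u ≠ 0`: the arbitrary element `f` is a
smooth function on an open domain `D`, and `f_u` is not identically zero on any nonempty open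
part of `D`. (In particular `f_u` may be nonzero everywhere, or `f` may be real-analytic on a
connected domain and not independent of `u`.) -/
def InClass (f : J0 → ℝ) (D : Set J0) : Prop :=
  IsOpen D ∧ ContDiffOn ℝ ∞ f D ∧
    ∀ O : Set J0, IsOpen O → O.Nonempty → O ⊆ D → ∃ y ∈ O, pd 2 f y ≠ 0

/-- The equation `K_f : u_tx = f(t, x, u)` as a subset of the second-order jet space. -/
def equationSet (f : J0 → ℝ) : Set J2 := {θ | θ.tx = f (proj θ.base)}

/-- `Φ = (T, X, U, U^t, U^x)` is a contact transformation on the open domain `Ω`: it is smooth,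
its Jacobian does not vanish, and the contact condition
`U^t D_t T + U^x D_t X = D_t U`, `U^t D_x T + U^x D_x X = D_x U` holds. -/
def IsContactTransformation (Φ : J1 → J1) (Ω : Set J1) : Prop :=
  IsOpen Ω ∧ ContDiffOn ℝ ∞ Φ Ω ∧ (∀ q ∈ Ω, (fderiv ℝ Φ q).det ≠ 0) ∧
    ∀ θ : J2, θ.base ∈ Ω →
      Φ θ.base 3 * totalDt (fun q => Φ q 0) θ + Φ θ.base 4 * totalDt (fun q => Φ q 1) θ
          = totalDt (fun q => Φ q 2) θ ∧
      Φ θ.base 3 * totalDx (fun q => Φ q 0) θ + Φ θ.base 4 * totalDx (fun q => Φ q 1) θ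
          = totalDx (fun q => Φ q 2) θ

/-- The determinant `D_t T · D_x X - D_x T · D_t X` on the second-order jet space. The second
prolongation of `Φ` is defined where it does not vanish. -/
noncomputable def det₂ (Φ : J1 → J1) (θ : J2) : ℝ :=
  totalDt (fun q => Φ q 0) θ * totalDx (fun q => Φ q 1) θ
    - totalDx (fun q => Φ q 0) θ * totalDt (fun q => Φ q 1) θ

/-- The second-order prolongation of the contact transformation `Φ = (T, X, U, U^t, U^x)`,
meaningful where `det₂ Φ θ ≠ 0`. The new second derivatives solve the chain rule equations
`D U^t = ũ_tt D T + ũ_tx D X` and `D U^x = ũ_tx D T + ũ_xx D X` for `D = D_t, D_x`. -/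
noncomputable def prolong₂ (Φ : J1 → J1) (θ : J2) : J2 where
  base := Φ θ.base
  tt := (totalDt (fun q => Φ q 3) θ * totalDx (fun q => Φ q 1) θ
    - totalDx (fun q => Φ q 3) θ * totalDt (fun q => Φ q 1) θ) / det₂ Φ θ
  tx := (totalDt (fun q => Φ q 0) θ * totalDx (fun q => Φ q 3) θ
    - totalDx (fun q => Φ q 0) θ * totalDt (fun q => Φ q 3) θ) / det₂ Φ θ
  xx := (totalDt (fun q => Φ q 0) θ * totalDx (fun q => Φ q 4) θ
    - totalDx (fun q => Φ q 0) θ * totalDt (fun q => Φ q 4) θ) / det₂ Φ θ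

/-- `Φ`, considered on `Ω`, maps the equation `u_tx = f` to the equation `u_tx = f'`: wherever it
is defined over `Ω`, the second-order prolongation of `Φ` takes points of the first equation to
points of the second one. -/
def MapsEquation (f : J0 → ℝ) (Φ : J1 → J1) (Ω : Set J1) (f' : J0 → ℝ) : Prop :=
  ∀ θ : J2, θ.base ∈ Ω → det₂ Φ θ ≠ 0 → θ ∈ equationSet f → prolong₂ Φ θ ∈ equationSet f'

/-- `(f, Φ, f')` is a contact admissible transformation within the class; here `D`, `Ω`, `D'`
are the domains of `f`, `Φ`, `f'`. -/
def IsContactAdmissible (f : J0 → ℝ) (D : Set J0) (Φ : J1 → J1) (Ω : Set J1)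
    (f' : J0 → ℝ) (D' : Set J0) : Prop :=
  InClass f D ∧ InClass f' D' ∧ IsContactTransformation Φ Ω ∧
    (∀ q ∈ Ω, proj q ∈ D) ∧ (∀ q ∈ Ω, proj (Φ q) ∈ D') ∧ MapsEquation f Φ Ω f'

/-- `φ = (T, X, U)` is a point transformation on the open domain `W`. -/
def IsPointTransformation (φ : J0 → J0) (W : Set J0) : Prop :=
  IsOpen W ∧ ContDiffOn ℝ ∞ φ W ∧ ∀ y ∈ W, (fderiv ℝ φ y).det ≠ 0

/-- The determinant `D_t T · D_x X - D_x T · D_t X` on the first-order jet space, for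
`φ = (T, X, U)`. -/
noncomputable def det₁ (φ : J0 → J0) (q : J1) : ℝ :=
  totalDt₀ (fun y => φ y 0) q * totalDx₀ (fun y => φ y 1) q
    - totalDx₀ (fun y => φ y 0) q * totalDt₀ (fun y => φ y 1) q

/-- The first-order prolongation of the point transformation `φ = (T, X, U)`, meaningful where
`det₁ φ q ≠ 0`. The new first derivatives solve the chain rule equations
`D U = ũ_t D T + ũ_x D X` for `D = D_t, D_x`. -/
noncomputable def prolong₁ (φ : J0 → J0) (q : J1) : J1 :=
  ![φ (proj q) 0, φ (proj q) 1, φ (proj q) 2,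
    (totalDt₀ (fun y => φ y 2) q * totalDx₀ (fun y => φ y 1) q
      - totalDx₀ (fun y => φ y 2) q * totalDt₀ (fun y => φ y 1) q) / det₁ φ q,
    (totalDt₀ (fun y => φ y 0) q * totalDx₀ (fun y => φ y 2) q
      - totalDx₀ (fun y => φ y 0) q * totalDt₀ (fun y => φ y 2) q) / det₁ φ q]

/-- The domain of the first-order prolongation of a point transformation `φ` on `W`. -/
def prolongDomain (φ : J0 → J0) (W : Set J0) : Set J1 := {q | proj q ∈ W ∧ det₁ φ q ≠ 0}

/-- `(f, φ, f')` is a point admissible transformation within the class; here `D`, `W`, `D'`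
are the domains of `f`, `φ`, `f'`. -/
def IsPointAdmissible (f : J0 → ℝ) (D : Set J0) (φ : J0 → J0) (W : Set J0)
    (f' : J0 → ℝ) (D' : Set J0) : Prop :=
  InClass f D ∧ InClass f' D' ∧ IsPointTransformation φ W ∧
    (∀ y ∈ W, y ∈ D) ∧ (∀ y ∈ W, φ y ∈ D') ∧
    MapsEquation f (prolong₁ φ) (prolongDomain φ W) f'

/-- On `Ω`, the transformation `Φ` is the first-order prolongation of a point transformation `φ`
of the projection of `Ω`, and `(f, φ, f')` is a point admissible transformation within the
class. -/
def IsProlongationOfPointAdmissible (f : J0 → ℝ) (D : Set J0) (Φ : J1 → J1) (Ω : Set J1)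
    (f' : J0 → ℝ) (D' : Set J0) : Prop :=
  ∃ φ : J0 → J0, IsPointAdmissible f D φ (proj '' Ω) f' D' ∧
    ∀ q ∈ Ω, det₁ φ q ≠ 0 ∧ Φ q = prolong₁ φ q

/-!
Write `Φ = (T, X, U, P, Q)` and let `e₀, e₁, e₂, e₃` be the frame `∂_t + u_t ∂_u + f ∂_{u_x}`,
`∂_x + u_x ∂_u + f ∂_{u_t}`, `∂_{u_t}`, `∂_{u_x}` of the contact distribution, so that on `K_f`
one has `D_t = e₀ + u_tt e₂` and `D_x = e₁ + u_xx e₃`.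

The contact condition says that `dU - P dT - Q dX` is a multiple `λ` of `du - u_t dt - u_x dx`,
where `λ ≠ 0` because the Jacobian does not vanish. The exterior derivative of this relation shows
that, on the frame, `T ∧ P + X ∧ Q` is `λ` times the standard symplectic form
(`IsContactTransformation.confSympl`). It follows that `det₂` never vanishes identically in
`(u_tt, u_xx)` over a point of `Ω` (`ConfSympl.det_ne`). Hence the condition that `K_f` is mapped to
`K_{f'}` is an identity between bilinear polynomials in `(u_tt, u_xx)`, and with `F = f'(T, X, U)`
it says that `T ∧ (P - F X)` has only the components on `e₀, e₂` and on `e₁, e₃`. Since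
`T ∧ (P - F X)` and `X ∧ (Q - F T)` are decomposable with sum `λ` times the symplectic form, either
`e₁ T = e₃ T = e₀ X = e₂ X = 0` or the same holds with the two characteristic directions
interchanged (`ConfSympl.split`). The two alternatives exclude each other and are closed, so each
holds on an open set.

A function killed by `∂_{u_x}` and `e₁` is killed by their commutator `∂_u`, and then by
`[∂_u, e₁] = f_u ∂_{u_t}`; as `f_u` is nonzero on a dense set it is killed by `∂_{u_t}` and `∂_x`
too (`InClass.pd_eq_zero`). So, locally, `T = T(t)` and `X = X(x)`, or `T = T(x)` and `X = X(t)`,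
and the contact condition gives that `U` does not depend on `u_t, u_x` either. When the fibres are
connected, `(T, X, U)` descends to a map `φ` of the space of `(t, x, u)`, and Cramer's rule
identifies `Φ` with its prolongation (`IsContactAdmissible.eq_prolong₁`). The first-order
prolongation of `φ` may be defined at points outside `Ω`; there the equation is still mapped
correctly because the new mixed derivative is, up to a factor constant on the fibre, a polynomial
in `(u_t, u_x)`, and the required identity holds on an open part of each fibre
(`IsContactAdmissible.mapsEquation`). The local assertion is the global one on small balls, whose
fibres are convex.
-/

/-! ### Partial derivatives -/

open Filter Topology in
lemma pd_congr {n : ℕ} {i : Fin n} {g h : (Fin n → ℝ) → ℝ} {y : Fin n → ℝ} (e : g =ᶠ[𝓝 y] h) :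
    pd i g y = pd i h y := by
  unfold pd; rw [e.fderiv_eq]

lemma pd_eqOn {n : ℕ} {i : Fin n} {g h : (Fin n → ℝ) → ℝ} {V : Set (Fin n → ℝ)} (hV : IsOpen V)
    (e : EqOn g h V) {y : Fin n → ℝ} (hy : y ∈ V) : pd i g y = pd i h y :=
  pd_congr (e.eventuallyEq_of_mem (hV.mem_nhds hy))

lemma pd_eq_zero {n : ℕ} {i : Fin n} {g : (Fin n → ℝ) → ℝ} {V : Set (Fin n → ℝ)} (hV : IsOpen V)
    (e : ∀ y ∈ V, g y = 0) {y : Fin n → ℝ} (hy : y ∈ V) : pd i g y = 0 := by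
  rw [pd_eqOn hV (h := fun _ => 0) e hy]; simp [pd]

lemma pd_add {n : ℕ} (i : Fin n) {g h : (Fin n → ℝ) → ℝ} {y : Fin n → ℝ}
    (hg : DifferentiableAt ℝ g y) (hh : DifferentiableAt ℝ h y) :
    pd i (fun z => g z + h z) y = pd i g y + pd i h y := by
  simp [pd, fderiv_fun_add hg hh]

lemma pd_sub {n : ℕ} (i : Fin n) {g h : (Fin n → ℝ) → ℝ} {y : Fin n → ℝ}
    (hg : DifferentiableAt ℝ g y) (hh : DifferentiableAt ℝ h y) :
    pd i (fun z => g z - h z) y = pd i g y - pd i h y := by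
  simp [pd, fderiv_fun_sub hg hh]

lemma pd_mul {n : ℕ} (i : Fin n) {g h : (Fin n → ℝ) → ℝ} {y : Fin n → ℝ}
    (hg : DifferentiableAt ℝ g y) (hh : DifferentiableAt ℝ h y) :
    pd i (fun z => g z * h z) y = pd i g y * h y + g y * pd i h y := by
  simp [pd, fderiv_fun_mul hg hh]; ring

lemma pd_coord {n : ℕ} (i j : Fin n) (y : Fin n → ℝ) :
    pd i (fun z => z j) y = if j = i then 1 else 0 := by
  simp [pd, fderiv_apply, Pi.single_apply]

lemma pd_contDiffOn {n : ℕ} (i : Fin n) {g : (Fin n → ℝ) → ℝ} {V : Set (Fin n → ℝ)}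
    (hV : IsOpen V) (hg : ContDiffOn ℝ ∞ g V) : ContDiffOn ℝ ∞ (pd i g) V :=
  (hg.fderiv_of_isOpen hV (m := ∞) (by simp)).clm_apply contDiffOn_const

lemma pd_comm {n : ℕ} (i j : Fin n) {g : (Fin n → ℝ) → ℝ} {V : Set (Fin n → ℝ)}
    (hV : IsOpen V) (hg : ContDiffOn ℝ ∞ g V) {y : Fin n → ℝ} (hy : y ∈ V) :
    pd i (pd j g) y = pd j (pd i g) y := by
  have hd : DifferentiableAt ℝ (fderiv ℝ g) y :=
    ((hg.fderiv_of_isOpen hV (m := ∞) (by simp)).differentiableOn (by simp)).differentiableAt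
      (hV.mem_nhds hy)
  have key : ∀ a b : Fin n, pd a (pd b g) y
      = fderiv ℝ (fderiv ℝ g) y (Pi.single a 1) (Pi.single b 1) := by
    intro a b
    unfold pd
    rw [fderiv_clm_apply hd (differentiableAt_const _)]
    simp
  have hs : IsSymmSndFDerivAt ℝ g y :=
    ((hg.contDiffAt (hV.mem_nhds hy))).isSymmSndFDerivAt (by
      simp only [minSmoothness_of_isRCLikeNormedField]; exact WithTop.coe_le_coe.2 le_top)
  rw [key, key, hs]

lemma diffAt_of_contDiffOn {n : ℕ} {g : (Fin n → ℝ) → ℝ} {V : Set (Fin n → ℝ)}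
    (hV : IsOpen V) (hg : ContDiffOn ℝ ∞ g V) {y : Fin n → ℝ} (hy : y ∈ V) :
    DifferentiableAt ℝ g y :=
  (hg.differentiableOn (by simp)).differentiableAt (hV.mem_nhds hy)

lemma fderiv_eq_sum_pd {n : ℕ} (g : (Fin n → ℝ) → ℝ) (y v : Fin n → ℝ) :
    fderiv ℝ g y v = ∑ i, v i * pd i g y := by
  conv_lhs => rw [pi_eq_sum_univ' v]
  simp [pd, map_sum]

/-! ### The projection to the space of `(t, x, u)` -/

/-- The projection `(t, x, u, u_t, u_x) ↦ (t, x, u)` as a continuous linear map. -/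
noncomputable def projL : J1 →L[ℝ] J0 :=
  ContinuousLinearMap.pi ![ContinuousLinearMap.proj 0, ContinuousLinearMap.proj 1,
    ContinuousLinearMap.proj 2]

lemma projL_apply (q : J1) : projL q = proj q := by
  ext i; fin_cases i <;> rfl

lemma proj_eq_projL : proj = projL := funext fun q => (projL_apply q).symm

lemma proj_isOpenMap : IsOpenMap proj := by
  rw [proj_eq_projL]
  refine projL.isOpenMap fun y => ⟨![y 0, y 1, y 2, 0, 0], ?_⟩
  rw [projL_apply]; ext i; fin_cases i <;> rfl

lemma proj_contDiff : ContDiff ℝ ∞ proj := by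
  rw [proj_eq_projL]; exact projL.contDiff

/-- The inclusion of the indices of `(t, x, u)` into those of `(t, x, u, u_t, u_x)`. -/
abbrev up (i : Fin 3) : Fin 5 := Fin.castLE (by norm_num) i

lemma pd_comp_proj (i : Fin 3) {g : J0 → ℝ} {q : J1} (hg : DifferentiableAt ℝ g (proj q)) :
    pd (up i) (fun z => g (proj z)) q = pd i g (proj q) := by
  unfold pd
  have : HasFDerivAt (fun z => g (proj z)) ((fderiv ℝ g (proj q)).comp projL) q := by
    refine HasFDerivAt.comp q hg.hasFDerivAt ?_
    rw [proj_eq_projL]; exact projL.hasFDerivAt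
  rw [this.fderiv, ContinuousLinearMap.comp_apply, projL_apply]
  congr 1; ext k; fin_cases i <;> fin_cases k <;> simp [proj, up]

lemma pd_comp_proj_fibre {k : Fin 5} (hk : k = 3 ∨ k = 4) {g : J0 → ℝ} {q : J1}
    (hg : DifferentiableAt ℝ g (proj q)) : pd k (fun z => g (proj z)) q = 0 := by
  unfold pd
  have : HasFDerivAt (fun z => g (proj z)) ((fderiv ℝ g (proj q)).comp projL) q := by
    refine HasFDerivAt.comp q hg.hasFDerivAt ?_
    rw [proj_eq_projL]; exact projL.hasFDerivAt
  rw [this.fderiv, ContinuousLinearMap.comp_apply, projL_apply]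
  have : proj (Pi.single k 1) = 0 := by
    rcases hk with rfl | rfl <;> ext k <;> fin_cases k <;> simp [proj]
  rw [this, map_zero]

/-! ### Pointwise linear algebra -/

/-- If a bilinear polynomial vanishes wherever another one does not, then one of the two is
zero. -/
lemma bilin_eq_zero_or {m₀ m₁ m₂ m₃ n₀ n₁ n₂ n₃ : ℝ}
    (h : ∀ r w : ℝ, n₀ + n₁ * r + n₂ * w + n₃ * (r * w) ≠ 0 →
      m₀ + m₁ * r + m₂ * w + m₃ * (r * w) = 0) :
    (m₀ = 0 ∧ m₁ = 0 ∧ m₂ = 0 ∧ m₃ = 0) ∨ (n₀ = 0 ∧ n₁ = 0 ∧ n₂ = 0 ∧ n₃ = 0) := by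
  have lin : ∀ a b c d : ℝ, (∀ r : ℝ, (a + b * r) * (c + d * r) = 0) →
      (a = 0 ∧ b = 0) ∨ (c = 0 ∧ d = 0) := by
    intro a b c d H
    have h0 := H 0
    have h1 := H 1
    have h2 := H (-1)
    have e0 : a * c = 0 := by linarith
    have e2 : b * d = 0 := by linarith
    have e1 : a * d + b * c = 0 := by linarith
    rcases mul_eq_zero.1 e0 with h | h <;> rcases mul_eq_zero.1 e2 with h' | h' <;> simp_all
  have P : ∀ w : ℝ, (m₀ + m₂ * w = 0 ∧ m₁ + m₃ * w = 0) ∨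
      (n₀ + n₂ * w = 0 ∧ n₁ + n₃ * w = 0) := by
    intro w
    refine lin _ _ _ _ fun r => ?_
    by_contra hne
    have hn := right_ne_zero_of_mul hne
    exact hne (mul_eq_zero_of_left (by have := h r w (by convert hn using 1; ring); linarith) _)
  have A : ∀ w : ℝ, (m₀ + m₂ * w) * (n₀ + n₂ * w) = 0 := fun w => by
    rcases P w with h | h <;> simp [h.1]
  have B : ∀ w : ℝ, (m₀ + m₂ * w) * (n₁ + n₃ * w) = 0 := fun w => by
    rcases P w with h | h <;> simp [h.1, h.2]
  have C : ∀ w : ℝ, (m₁ + m₃ * w) * (n₀ + n₂ * w) = 0 := fun w => by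
    rcases P w with h | h <;> simp [h.1, h.2]
  have D : ∀ w : ℝ, (m₁ + m₃ * w) * (n₁ + n₃ * w) = 0 := fun w => by
    rcases P w with h | h <;> simp [h.2]
  have := lin _ _ _ _ A
  have := lin _ _ _ _ B
  have := lin _ _ _ _ C
  have := lin _ _ _ _ D
  tauto

/-- The relations saying that the `2`-form `T ∧ P + X ∧ Q` on a four-dimensional space with
coordinates indexed by `0, 1, 2, 3` equals `l` times the form `e₀ ∧ e₂ + e₁ ∧ e₃`. -/
structure ConfSympl (T X P Q : Fin 4 → ℝ) (l : ℝ) : Prop where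
  h01 : T 0 * P 1 - T 1 * P 0 + (X 0 * Q 1 - X 1 * Q 0) = 0
  h03 : T 0 * P 3 - T 3 * P 0 + (X 0 * Q 3 - X 3 * Q 0) = 0
  h12 : T 1 * P 2 - T 2 * P 1 + (X 1 * Q 2 - X 2 * Q 1) = 0
  h23 : T 2 * P 3 - T 3 * P 2 + (X 2 * Q 3 - X 3 * Q 2) = 0
  h02 : T 0 * P 2 - T 2 * P 0 + (X 0 * Q 2 - X 2 * Q 0) = l
  h13 : T 1 * P 3 - T 3 * P 1 + (X 1 * Q 3 - X 3 * Q 1) = l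

/-- The components of `T ∧ X` off the two symplectic planes cannot all vanish. In the application
they are, up to sign, the coefficients of `det₂` as a polynomial in `u_tt, u_xx`. -/
lemma ConfSympl.det_ne {T X P Q : Fin 4 → ℝ} {l : ℝ} (h : ConfSympl T X P Q l) (hl : l ≠ 0)
    (h01 : T 0 * X 1 - T 1 * X 0 = 0) (h03 : T 0 * X 3 - T 3 * X 0 = 0)
    (h12 : T 1 * X 2 - T 2 * X 1 = 0) (h23 : T 2 * X 3 - T 3 * X 2 = 0) : False := by
  obtain ⟨k01, k03, k12, k23, k02, k13⟩ := h
  generalize T 0 = t0, T 1 = t1, T 2 = t2, T 3 = t3, X 0 = x0, X 1 = x1, X 2 = x2, X 3 = x3,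
    P 0 = p0, P 1 = p1, P 2 = p2, P 3 = p3, Q 0 = q0, Q 1 = q1, Q 2 = q2, Q 3 = q3 at *
  by_cases a : t0 * x2 - t2 * x0 = 0
  · by_cases b : t1 * x3 - t3 * x1 = 0
    · -- the square of `T ∧ P + X ∧ Q` is a combination of the minors of `T ∧ X`, now all zero,
      -- and the square of the symplectic form is not zero
      apply hl
      refine pow_eq_zero_iff (two_ne_zero) |>.1 ?_
      linear_combination (-(t1 * p3 - t3 * p1 + (x1 * q3 - x3 * q1))) * k02 - l * k13
        + (t2 * p3 - t3 * p2 + (x2 * q3 - x3 * q2)) * k01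
        + (t1 * p2 - t2 * p1 + (x1 * q2 - x2 * q1)) * k03
        + (p2 * q3 - p3 * q2) * h01 + (p1 * q2 - p2 * q1) * h03
        + (p0 * q3 - p3 * q0) * h12 + (p0 * q1 - p1 * q0) * h23
        - (p1 * q3 - p3 * q1) * a - (p0 * q2 - p2 * q0) * b
    · have z1 : t0 = 0 := mul_left_cancel₀ b (by linear_combination t1 * h03 - t3 * h01)
      have z2 : x0 = 0 := mul_left_cancel₀ b (by linear_combination x1 * h03 - x3 * h01)
      have z3 : t2 = 0 := mul_left_cancel₀ b (by linear_combination t1 * h23 + t3 * h12)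
      have z4 : x2 = 0 := mul_left_cancel₀ b (by linear_combination x1 * h23 + x3 * h12)
      apply hl; rw [← k02, z1, z2, z3, z4]; ring
  · have z1 : t1 = 0 := mul_left_cancel₀ a (by linear_combination t0 * h12 + t2 * h01)
    have z2 : x1 = 0 := mul_left_cancel₀ a (by linear_combination x0 * h12 + x2 * h01)
    have z3 : t3 = 0 := mul_left_cancel₀ a (by linear_combination t2 * h03 - t0 * h23)
    have z4 : x3 = 0 := mul_left_cancel₀ a (by linear_combination x2 * h03 - x0 * h23)
    apply hl; rw [← k13, z1, z2, z3, z4]; ring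

/-- If `T ∧ P` has only the components on the two symplectic planes, then so has `X ∧ Q`. As both are
decomposable, each is supported on one plane, and these planes are different. -/
lemma ConfSympl.split {T X P Q : Fin 4 → ℝ} {l : ℝ} (h : ConfSympl T X P Q l) (hl : l ≠ 0)
    (h01 : T 0 * P 1 - T 1 * P 0 = 0) (h03 : T 0 * P 3 - T 3 * P 0 = 0)
    (h12 : T 1 * P 2 - T 2 * P 1 = 0) (h23 : T 2 * P 3 - T 3 * P 2 = 0) :
    (T 1 = 0 ∧ T 3 = 0 ∧ X 0 = 0 ∧ X 2 = 0) ∨ (T 0 = 0 ∧ T 2 = 0 ∧ X 1 = 0 ∧ X 3 = 0) := by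
  obtain ⟨k01, k03, k12, k23, k02, k13⟩ := h
  generalize T 0 = t0, T 1 = t1, T 2 = t2, T 3 = t3, X 0 = x0, X 1 = x1, X 2 = x2, X 3 = x3,
    P 0 = p0, P 1 = p1, P 2 = p2, P 3 = p3, Q 0 = q0, Q 1 = q1, Q 2 = q2, Q 3 = q3 at *
  rw [h01, zero_add] at k01
  rw [h03, zero_add] at k03
  rw [h12, zero_add] at k12
  rw [h23, zero_add] at k23
  -- the Plücker relations of the two decomposable forms
  have pT : (t0 * p2 - t2 * p0) * (t1 * p3 - t3 * p1) = 0 := by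
    linear_combination (t2 * p3 - t3 * p2) * h01 + (t1 * p2 - t2 * p1) * h03
  have pX : (x0 * q2 - x2 * q0) * (x1 * q3 - x3 * q1) = 0 := by
    linear_combination (x2 * q3 - x3 * q2) * k01 + (x1 * q2 - x2 * q1) * k03
  rcases mul_eq_zero.1 pT with a | b
  · right
    rw [a, zero_add] at k02
    have b' := (mul_eq_zero.1 pX).resolve_left (k02 ▸ hl)
    rw [b', add_zero] at k13
    subst k02
    refine ⟨mul_left_cancel₀ (k13 ▸ hl) ?_, mul_left_cancel₀ (k13 ▸ hl) ?_,
      mul_left_cancel₀ hl ?_, mul_left_cancel₀ hl ?_⟩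
    · linear_combination t1 * h03 - t3 * h01
    · linear_combination t1 * h23 + t3 * h12
    · linear_combination x0 * k12 + x2 * k01
    · linear_combination x2 * k03 - x0 * k23
  · left
    rw [b, zero_add] at k13
    have a' := (mul_eq_zero.1 pX).resolve_right (k13 ▸ hl)
    rw [a', add_zero] at k02
    subst k02
    refine ⟨mul_left_cancel₀ hl ?_, mul_left_cancel₀ hl ?_,
      mul_left_cancel₀ (k13 ▸ hl) ?_, mul_left_cancel₀ (k13 ▸ hl) ?_⟩
    · linear_combination t0 * h12 + t2 * h01
    · linear_combination t2 * h03 - t0 * h23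
    · linear_combination x1 * k03 - x3 * k01
    · linear_combination x1 * k23 + x3 * k12

/-- Adding the same multiple of `X` to `P` and of `T` to `Q` does not change `T ∧ P + X ∧ Q`. -/
lemma ConfSympl.shift {T X P Q : Fin 4 → ℝ} {l : ℝ} (h : ConfSympl T X P Q l) (F : ℝ) :
    ConfSympl T X (P - F • X) (Q - F • T) l := by
  obtain ⟨k01, k03, k12, k23, k02, k13⟩ := h
  constructor <;> simp only [Pi.sub_apply, Pi.smul_apply, smul_eq_mul] <;>
    [rw [← k01]; rw [← k03]; rw [← k12]; rw [← k23]; rw [← k02]; rw [← k13]] <;> ring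

/-! ### Contact transformations -/

/-- The coefficients of the one-form `dU - U^t dT - U^x dX` for `Φ = (T, X, U, U^t, U^x)`. -/
noncomputable def contactCoeff (Φ : J1 → J1) (i : Fin 5) (q : J1) : ℝ :=
  pd i (fun z => Φ z 2) q - Φ q 3 * pd i (fun z => Φ z 0) q - Φ q 4 * pd i (fun z => Φ z 1) q

/-- The derivatives of `g` along the frame `∂_t + u_t ∂_u + s ∂_{u_x}`,
`∂_x + u_x ∂_u + s ∂_{u_t}`, `∂_{u_t}`, `∂_{u_x}` of the contact distribution. For `u_tx = s` the
first two are the total derivatives without their terms in `u_tt`, `u_xx`. -/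
noncomputable def jetDeriv (s : ℝ) (g : J1 → ℝ) (q : J1) : Fin 4 → ℝ :=
  ![pd 0 g q + q 3 * pd 2 g q + s * pd 4 g q, pd 1 g q + q 4 * pd 2 g q + s * pd 3 g q,
    pd 3 g q, pd 4 g q]

lemma totalDt_eq (g : J1 → ℝ) (θ : J2) :
    totalDt g θ = jetDeriv θ.tx g θ.base 0 + θ.tt * jetDeriv θ.tx g θ.base 2 := by
  simp [totalDt, jetDeriv]; ring

lemma totalDx_eq (g : J1 → ℝ) (θ : J2) :
    totalDx g θ = jetDeriv θ.tx g θ.base 1 + θ.xx * jetDeriv θ.tx g θ.base 3 := by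
  simp [totalDx, jetDeriv]

lemma IsContactTransformation.smooth {Φ : J1 → J1} {Ω : Set J1}
    (hc : IsContactTransformation Φ Ω) (i : Fin 5) : ContDiffOn ℝ ∞ (fun q => Φ q i) Ω :=
  contDiffOn_pi.1 hc.2.1 i

lemma IsContactTransformation.diffAt {Φ : J1 → J1} {Ω : Set J1}
    (hc : IsContactTransformation Φ Ω) (i : Fin 5) {q : J1} (hq : q ∈ Ω) :
    DifferentiableAt ℝ (fun q => Φ q i) q :=
  diffAt_of_contDiffOn hc.1 (hc.smooth i) hq

/-- The pulled back contact form is proportional to `du - u_t dt - u_x dx`. -/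
lemma IsContactTransformation.contactCoeff_eq {Φ : J1 → J1} {Ω : Set J1}
    (hc : IsContactTransformation Φ Ω) {q : J1} (hq : q ∈ Ω) :
    contactCoeff Φ 0 q = - (q 3 * contactCoeff Φ 2 q) ∧
      contactCoeff Φ 1 q = - (q 4 * contactCoeff Φ 2 q) ∧
      contactCoeff Φ 3 q = 0 ∧ contactCoeff Φ 4 q = 0 := by
  have h := hc.2.2.2
  have h0 := h ⟨q, 0, 0, 0⟩ hq
  have h1 := h ⟨q, 1, 0, 0⟩ hq
  have h2 := h ⟨q, 0, 0, 1⟩ hq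
  simp only [totalDt, totalDx] at h0 h1 h2
  simp only [contactCoeff]
  refine ⟨?_, ?_, ?_, ?_⟩
  · linear_combination -h0.1
  · linear_combination -h0.2
  · linear_combination h0.1 - h1.1
  · linear_combination h0.2 - h2.2

/-- Otherwise `dU - U^t dT - U^x dX = 0` would be a linear relation between the rows of the
Jacobian matrix. -/
lemma IsContactTransformation.contactCoeff_ne_zero {Φ : J1 → J1} {Ω : Set J1}
    (hc : IsContactTransformation Φ Ω) {q : J1} (hq : q ∈ Ω) :
    contactCoeff Φ 2 q ≠ 0 := by
  intro h2
  obtain ⟨h0, h1, h3, h4⟩ := hc.contactCoeff_eq hq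
  rw [h2, mul_zero, neg_zero] at h0 h1
  have hdiff : DifferentiableAt ℝ Φ q :=
    (hc.2.1.differentiableOn (by simp)).differentiableAt (hc.1.mem_nhds hq)
  have hcomp : ∀ (v : J1) (i : Fin 5), fderiv ℝ Φ q v i = fderiv ℝ (fun z => Φ z i) q v := by
    intro v i
    rw [fderiv_pi (fun i => hc.diffAt i hq)]; rfl
  have hker : ∀ v, fderiv ℝ Φ q v 2 - Φ q 3 * fderiv ℝ Φ q v 0 - Φ q 4 * fderiv ℝ Φ q v 1 = 0 := by
    intro v
    simp only [hcomp, fderiv_eq_sum_pd, Fin.sum_univ_five]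
    simp only [contactCoeff] at h0 h1 h2 h3 h4
    linear_combination v 0 * h0 + v 1 * h1 + v 2 * h2 + v 3 * h3 + v 4 * h4
  have hsurj : Function.Surjective (fderiv ℝ Φ q : J1 →ₗ[ℝ] J1) :=
    ((Module.End.isUnit_iff _).1 (LinearMap.isUnit_iff_isUnit_det _ |>.2
      (isUnit_iff_ne_zero.2 (hc.2.2.1 q hq)))).surjective
  obtain ⟨v, hv⟩ := hsurj (Pi.single 2 1)
  have := hker v
  simp only [ContinuousLinearMap.coe_coe] at hv
  rw [hv] at this
  simp at this

lemma IsContactTransformation.contactCoeff_smooth {Φ : J1 → J1} {Ω : Set J1}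
    (hc : IsContactTransformation Φ Ω) (i : Fin 5) :
    ContDiffOn ℝ ∞ (contactCoeff Φ i) Ω := by
  have := fun j => pd_contDiffOn i hc.1 (hc.smooth j)
  exact ((this 2).sub ((hc.smooth 3).mul (this 0))).sub ((hc.smooth 4).mul (this 1))

/-- The coefficients of the exterior derivative of `dU - U^t dT - U^x dX`. -/
lemma IsContactTransformation.pd_contactCoeff {Φ : J1 → J1} {Ω : Set J1}
    (hc : IsContactTransformation Φ Ω) (i j : Fin 5) {q : J1} (hq : q ∈ Ω) :
    pd i (contactCoeff Φ j) q - pd j (contactCoeff Φ i) q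
      = pd i (fun z => Φ z 0) q * pd j (fun z => Φ z 3) q
        - pd j (fun z => Φ z 0) q * pd i (fun z => Φ z 3) q
        + (pd i (fun z => Φ z 1) q * pd j (fun z => Φ z 4) q
        - pd j (fun z => Φ z 1) q * pd i (fun z => Φ z 4) q) := by
  have d := fun k (i : Fin 5) =>
    diffAt_of_contDiffOn hc.1 (pd_contDiffOn i hc.1 (hc.smooth k)) hq
  have e : ∀ i j : Fin 5, pd i (contactCoeff Φ j) q
      = pd i (pd j (fun z => Φ z 2)) q
        - (pd i (fun z => Φ z 3) q * pd j (fun z => Φ z 0) q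
          + Φ q 3 * pd i (pd j (fun z => Φ z 0)) q)
        - (pd i (fun z => Φ z 4) q * pd j (fun z => Φ z 1) q
          + Φ q 4 * pd i (pd j (fun z => Φ z 1)) q) := by
    intro i j
    have h3 := hc.diffAt 3 hq
    have h4 := hc.diffAt 4 hq
    unfold contactCoeff
    rw [pd_sub i ((d 2 j).fun_sub (h3.fun_mul (d 0 j))) (h4.fun_mul (d 1 j)),
      pd_sub i (d 2 j) (h3.fun_mul (d 0 j)), pd_mul i h3 (d 0 j), pd_mul i h4 (d 1 j)]
  rw [e, e, pd_comm i j hc.1 (hc.smooth 2) hq, pd_comm i j hc.1 (hc.smooth 0) hq,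
    pd_comm i j hc.1 (hc.smooth 1) hq]
  ring

/-- A contact transformation is conformally symplectic on the contact distribution. -/
lemma IsContactTransformation.confSympl {Φ : J1 → J1} {Ω : Set J1}
    (hc : IsContactTransformation Φ Ω) (s : ℝ) {q : J1} (hq : q ∈ Ω) :
    ConfSympl (jetDeriv s (fun z => Φ z 0) q) (jetDeriv s (fun z => Φ z 1) q)
      (jetDeriv s (fun z => Φ z 3) q) (jetDeriv s (fun z => Φ z 4) q) (contactCoeff Φ 2 q) := by
  have hl := diffAt_of_contDiffOn hc.1 (hc.contactCoeff_smooth 2) hq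
  have hco : ∀ k : Fin 5, DifferentiableAt ℝ (fun z : J1 => z k) q := fun k => by fun_prop
  have z3 : ∀ i, pd i (contactCoeff Φ 3) q = 0 := fun i =>
    pd_eq_zero hc.1 (fun y hy => (hc.contactCoeff_eq hy).2.2.1) hq
  have z4 : ∀ i, pd i (contactCoeff Φ 4) q = 0 := fun i =>
    pd_eq_zero hc.1 (fun y hy => (hc.contactCoeff_eq hy).2.2.2) hq
  have z : ∀ (a k : Fin 5) (_ : ∀ y ∈ Ω, contactCoeff Φ a y = - (y k * contactCoeff Φ 2 y))
      (i : Fin 5), pd i (contactCoeff Φ a) q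
        = - ((if k = i then 1 else 0) * contactCoeff Φ 2 q
          + q k * pd i (contactCoeff Φ 2) q) := by
    intro a k hak i
    rw [pd_eqOn hc.1 (h := fun y => (fun _ => (0 : ℝ)) y - y k * contactCoeff Φ 2 y)
      (fun y hy => by simp [hak y hy]) hq, pd_sub i (differentiableAt_const _)
      ((hco k).fun_mul hl), pd_mul i (hco k) hl, pd_coord]
    simp [pd]
  have z0 := z 0 3 (fun y hy => (hc.contactCoeff_eq hy).1)
  have z1 := z 1 4 (fun y hy => (hc.contactCoeff_eq hy).2.1)
  have w := fun i j => hc.pd_contactCoeff i j hq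
  have w01 := w 0 1
  have w02 := w 0 2
  have w03 := w 0 3
  have w04 := w 0 4
  have w12 := w 1 2
  have w13 := w 1 3
  have w14 := w 1 4
  have w23 := w 2 3
  have w24 := w 2 4
  have w34 := w 3 4
  simp only [z0, z1, z3, z4] at w01 w02 w03 w04 w12 w13 w14 w23 w24 w34
  simp at w01 w02 w03 w04 w12 w13 w14 w23 w24 w34
  constructor <;> simp only [jetDeriv, Matrix.cons_val]
  · linear_combination -w01 - q 4 * w02 + q 3 * w12 - s * w03 - s * q 3 * w23 + s * w14
      + s * q 4 * w24 + s ^ 2 * w34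
  · linear_combination -w04 - q 3 * w24
  · linear_combination -w13 - q 4 * w23
  · linear_combination -w34
  · linear_combination -w03 - q 3 * w23 + s * w34
  · linear_combination -w14 - q 4 * w24 - s * w34

/-! ### Functions constant along characteristics -/

lemma smooth_comp_proj {f : J0 → ℝ} {D : Set J0} (hf : ContDiffOn ℝ ∞ f D)
    {V : Set J1} (hVD : ∀ q ∈ V, proj q ∈ D) : ContDiffOn ℝ ∞ (fun q => f (proj q)) V :=
  hf.comp proj_contDiff.contDiffOn hVD

/-- A function annihilated by `∂_k` and by `∂_i + z_k ∂_u + f ∂_j`, where `z_k`, `z_j` are the two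
derivative coordinates, is annihilated by all of `∂_i`, `∂_u`, `∂_j`, because commutators produce
first `∂_u` and then `f_u ∂_j`. -/
lemma InClass.pd_eq_zero {f : J0 → ℝ} {D : Set J0} (hf : InClass f D) {V : Set J1} (hV : IsOpen V)
    (hVD : ∀ q ∈ V, proj q ∈ D) {g : J1 → ℝ} (hg : ContDiffOn ℝ ∞ g V) {i j k : Fin 5}
    (hk : k = 3 ∨ k = 4)
    (h1 : ∀ z ∈ V, pd k g z = 0)
    (h2 : ∀ z ∈ V, pd i g z + z k * pd 2 g z + f (proj z) * pd j g z = 0) :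
    ∀ z ∈ V, pd i g z = 0 ∧ pd 2 g z = 0 ∧ pd j g z = 0 := by
  obtain ⟨hD, hfs, hfu⟩ := hf
  have d := fun (a : Fin 5) {z : J1} (hz : z ∈ V) =>
    diffAt_of_contDiffOn hV (pd_contDiffOn a hV hg) hz
  have df := fun {z : J1} (hz : z ∈ V) =>
    diffAt_of_contDiffOn hV (smooth_comp_proj hfs hVD) hz
  have dc : ∀ z : J1, DifferentiableAt ℝ (fun z : J1 => z k) z := fun z => by fun_prop
  have expand : ∀ m : Fin 5, ∀ z ∈ V,
      pd m (pd i g) z + ((if k = m then 1 else 0) * pd 2 g z + z k * pd m (pd 2 g) z)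
        + (pd m (fun q => f (proj q)) z * pd j g z + f (proj z) * pd m (pd j g) z) = 0 := by
    intro m z hz
    have := _root_.pd_eq_zero (i := m) hV h2 hz
    rwa [pd_add m ((d i hz).fun_add ((dc z).fun_mul (d 2 hz))) ((df hz).fun_mul (d j hz)),
      pd_add m (d i hz) ((dc z).fun_mul (d 2 hz)), pd_mul m (dc z) (d 2 hz),
      pd_mul m (df hz) (d j hz), pd_coord] at this
  have hc0 : ∀ a : Fin 5, ∀ z ∈ V, pd k (pd a g) z = 0 := fun a z hz => by
    rw [pd_comm k a hV hg hz]; exact _root_.pd_eq_zero hV h1 hz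
  have hu : ∀ z ∈ V, pd 2 g z = 0 := by
    intro z hz
    have := expand k z hz
    rw [hc0 i z hz, hc0 2 z hz, hc0 j z hz, pd_comp_proj_fibre hk
      (diffAt_of_contDiffOn hD hfs (hVD z hz))] at this
    simpa using this
  have hu0 : ∀ a : Fin 5, ∀ z ∈ V, pd 2 (pd a g) z = 0 := fun a z hz => by
    rw [pd_comm 2 a hV hg hz]; exact _root_.pd_eq_zero hV hu hz
  have hfj : ∀ z ∈ V, pd 2 f (proj z) * pd j g z = 0 := by
    intro z hz
    have := expand 2 z hz
    rw [hu0 i z hz, hu0 2 z hz, hu0 j z hz, hu z hz] at this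
    have e := pd_comp_proj 2 (diffAt_of_contDiffOn hD hfs (hVD z hz))
    have e' : (up 2 : Fin 5) = 2 := rfl
    rw [e'] at e
    rw [e] at this
    simpa using this
  have hj : ∀ z ∈ V, pd j g z = 0 := by
    intro z hz
    by_contra hne
    have hcont : ContinuousOn (pd j g) V := (pd_contDiffOn j hV hg).continuousOn
    have hO : IsOpen (V ∩ pd j g ⁻¹' {0}ᶜ) :=
      hcont.isOpen_inter_preimage hV isOpen_compl_singleton
    obtain ⟨y, ⟨w, hw, rfl⟩, hy⟩ := hfu (proj '' (V ∩ pd j g ⁻¹' {0}ᶜ))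
      (proj_isOpenMap _ hO) ⟨_, z, ⟨hz, hne⟩, rfl⟩ (by rintro _ ⟨w, hw, rfl⟩; exact hVD w hw.1)
    exact (mul_ne_zero hy hw.2) (hfj w hw.1)
  intro z hz
  refine ⟨?_, hu z hz, hj z hz⟩
  have := h2 z hz
  rw [hu z hz, hj z hz] at this
  simpa using this

/-! ### The structure of contact admissible transformations -/

section Admissible
variable {f f' : J0 → ℝ} {D D' : Set J0} {Φ : J1 → J1} {Ω : Set J1}

/-- At each point the two characteristic directions are either preserved or interchanged. -/
lemma IsContactAdmissible.jetDeriv_split (h : IsContactAdmissible f D Φ Ω f' D') {q : J1}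
    (hq : q ∈ Ω) :
    (jetDeriv (f (proj q)) (fun z => Φ z 0) q 1 = 0 ∧
      jetDeriv (f (proj q)) (fun z => Φ z 0) q 3 = 0 ∧
      jetDeriv (f (proj q)) (fun z => Φ z 1) q 0 = 0 ∧
      jetDeriv (f (proj q)) (fun z => Φ z 1) q 2 = 0) ∨
    (jetDeriv (f (proj q)) (fun z => Φ z 0) q 0 = 0 ∧
      jetDeriv (f (proj q)) (fun z => Φ z 0) q 2 = 0 ∧
      jetDeriv (f (proj q)) (fun z => Φ z 1) q 1 = 0 ∧
      jetDeriv (f (proj q)) (fun z => Φ z 1) q 3 = 0) := by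
  obtain ⟨-, -, hc, -, -, hm⟩ := h
  have hS := hc.confSympl (f (proj q)) hq
  have hl := hc.contactCoeff_ne_zero hq
  set F := f' (proj (Φ q)) with hF
  set T := jetDeriv (f (proj q)) (fun z => Φ z 0) q with hT
  set X := jetDeriv (f (proj q)) (fun z => Φ z 1) q with hX
  set P := jetDeriv (f (proj q)) (fun z => Φ z 3) q with hP
  -- the equation of the image, multiplied by `det₂`, is bilinear in `(u_tt, u_xx)`
  have key : ∀ r w : ℝ, (T 0 * X 1 - T 1 * X 0) + (T 2 * X 1 - T 1 * X 2) * r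
        + (T 0 * X 3 - T 3 * X 0) * w + (T 2 * X 3 - T 3 * X 2) * (r * w) ≠ 0 →
      (T 0 * (P - F • X) 1 - T 1 * (P - F • X) 0)
        + (T 2 * (P - F • X) 1 - T 1 * (P - F • X) 2) * r
        + (T 0 * (P - F • X) 3 - T 3 * (P - F • X) 0) * w
        + (T 2 * (P - F • X) 3 - T 3 * (P - F • X) 2) * (r * w) = 0 := by
    intro r w hne
    have hdet : det₂ Φ ⟨q, r, f (proj q), w⟩ = (T 0 * X 1 - T 1 * X 0)
        + (T 2 * X 1 - T 1 * X 2) * r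
        + (T 0 * X 3 - T 3 * X 0) * w + (T 2 * X 3 - T 3 * X 2) * (r * w) := by
      simp only [det₂, totalDt_eq, totalDx_eq, ← hT, ← hX]; ring
    have hd : det₂ Φ ⟨q, r, f (proj q), w⟩ ≠ 0 := by rw [hdet]; exact hne
    have := hm ⟨q, r, f (proj q), w⟩ hq hd rfl
    simp only [equationSet, mem_ofPred_eq, prolong₂] at this
    rw [div_eq_iff hd, hdet] at this
    simp only [totalDt_eq, totalDx_eq, ← hT, ← hP, ← hF] at this
    simp only [Pi.sub_apply, Pi.smul_apply, smul_eq_mul]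
    linear_combination this
  rcases bilin_eq_zero_or key with ⟨a, b, c, d⟩ | ⟨a, b, c, d⟩
  · exact (hS.shift F).split hl a c (by linear_combination -b) d
  · exact (hS.det_ne hl a c (by linear_combination -b) d).elim

/-- Near each point either `T` depends on `t` and `X` depends on `x` only, or conversely. -/
lemma IsContactAdmissible.exists_nhd (h : IsContactAdmissible f D Φ Ω f' D') {q : J1}
    (hq : q ∈ Ω) : ∃ V : Set J1, IsOpen V ∧ q ∈ V ∧ V ⊆ Ω ∧
      (∀ z ∈ V, ∀ k : Fin 5, k = 3 ∨ k = 4 →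
        pd k (fun z => Φ z 0) z = 0 ∧ pd k (fun z => Φ z 1) z = 0) ∧
      (∀ z ∈ V, pd 2 (fun z => Φ z 0) z = 0 ∧ pd 2 (fun z => Φ z 1) z = 0) ∧
      ((∀ z ∈ V, pd 1 (fun z => Φ z 0) z = 0 ∧ pd 0 (fun z => Φ z 1) z = 0) ∨
      (∀ z ∈ V, pd 0 (fun z => Φ z 0) z = 0 ∧ pd 1 (fun z => Φ z 1) z = 0)) := by
  have hcl := h.1
  have hc := h.2.2.1
  have hD := h.2.2.2.1
  have cont : ∀ k : Fin 4, ContinuousOn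
      (fun z => jetDeriv (f (proj z)) (fun z => Φ z 0) z k) Ω := by
    intro k
    have hpd := fun i => (pd_contDiffOn i hc.1 (hc.smooth 0)).continuousOn
    have hfc := (smooth_comp_proj hcl.2.1 hD).continuousOn
    have hco : ∀ k : Fin 5, ContinuousOn (fun z : J1 => z k) Ω := fun k => by fun_prop
    fin_cases k
    · exact ((hpd 0).add ((hco 3).mul (hpd 2))).add (hfc.mul (hpd 4))
    · exact ((hpd 1).add ((hco 4).mul (hpd 2))).add (hfc.mul (hpd 3))
    · exact hpd 3
    · exact hpd 4
  have op : ∀ k : Fin 4, IsOpen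
      (Ω ∩ (fun z => jetDeriv (f (proj z)) (fun z => Φ z 0) z k) ⁻¹' {0}ᶜ) := fun k =>
    (cont k).isOpen_inter_preimage hc.1 isOpen_compl_singleton
  rcases h.jetDeriv_split hq with ⟨a1, a3, b0, b2⟩ | ⟨a0, a2, b1, b3⟩
  · refine ⟨(Ω ∩ (fun z => jetDeriv (f (proj z)) (fun z => Φ z 0) z 0) ⁻¹' {0}ᶜ) ∪
      (Ω ∩ (fun z => jetDeriv (f (proj z)) (fun z => Φ z 0) z 2) ⁻¹' {0}ᶜ),
      (op 0).union (op 2), ?_, by simp, ?_⟩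
    · by_contra hn
      simp only [mem_union, mem_inter_iff, hq, true_and, mem_preimage, mem_compl_iff,
        mem_singleton_iff, not_or, not_not] at hn
      apply hc.contactCoeff_ne_zero hq
      rw [← (hc.confSympl (f (proj q)) hq).h02, hn.1, hn.2, b0, b2]; ring
    set V := (Ω ∩ (fun z => jetDeriv (f (proj z)) (fun z => Φ z 0) z 0) ⁻¹' {0}ᶜ) ∪
      (Ω ∩ (fun z => jetDeriv (f (proj z)) (fun z => Φ z 0) z 2) ⁻¹' {0}ᶜ) with hV
    have hVo : IsOpen V := (op 0).union (op 2)
    have hsub : V ⊆ Ω := by simp [hV]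
    have hs : ∀ z ∈ V, _ := fun z hz => (h.jetDeriv_split (hsub hz)).resolve_right (by
      rintro ⟨e0, e2, -⟩
      rcases hz with hz | hz
      exacts [hz.2 e0, hz.2 e2])
    have hT := hcl.pd_eq_zero hVo (fun z hz => hD z (hsub hz)) ((hc.smooth 0).mono hsub)
      (i := 1) (j := 3) (k := 4) (Or.inr rfl) (fun z hz => (hs z hz).2.1) (fun z hz => (hs z hz).1)
    have hX := hcl.pd_eq_zero hVo (fun z hz => hD z (hsub hz)) ((hc.smooth 1).mono hsub)
      (i := 0) (j := 4) (k := 3) (Or.inl rfl) (fun z hz => (hs z hz).2.2.2)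
      (fun z hz => (hs z hz).2.2.1)
    refine ⟨?_, fun z hz => ⟨(hT z hz).2.1, (hX z hz).2.1⟩,
      Or.inl fun z hz => ⟨(hT z hz).1, (hX z hz).1⟩⟩
    rintro z hz k (rfl | rfl)
    exacts [⟨(hT z hz).2.2, (hs z hz).2.2.2⟩, ⟨(hs z hz).2.1, (hX z hz).2.2⟩]
  · refine ⟨(Ω ∩ (fun z => jetDeriv (f (proj z)) (fun z => Φ z 0) z 1) ⁻¹' {0}ᶜ) ∪
      (Ω ∩ (fun z => jetDeriv (f (proj z)) (fun z => Φ z 0) z 3) ⁻¹' {0}ᶜ),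
      (op 1).union (op 3), ?_, by simp, ?_⟩
    · by_contra hn
      simp only [mem_union, mem_inter_iff, hq, true_and, mem_preimage, mem_compl_iff,
        mem_singleton_iff, not_or, not_not] at hn
      apply hc.contactCoeff_ne_zero hq
      rw [← (hc.confSympl (f (proj q)) hq).h13, hn.1, hn.2, b1, b3]; ring
    set V := (Ω ∩ (fun z => jetDeriv (f (proj z)) (fun z => Φ z 0) z 1) ⁻¹' {0}ᶜ) ∪
      (Ω ∩ (fun z => jetDeriv (f (proj z)) (fun z => Φ z 0) z 3) ⁻¹' {0}ᶜ) with hV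
    have hVo : IsOpen V := (op 1).union (op 3)
    have hsub : V ⊆ Ω := by simp [hV]
    have hs : ∀ z ∈ V, _ := fun z hz => (h.jetDeriv_split (hsub hz)).resolve_left (by
      rintro ⟨e0, e2, -⟩
      rcases hz with hz | hz
      exacts [hz.2 e0, hz.2 e2])
    have hT := hcl.pd_eq_zero hVo (fun z hz => hD z (hsub hz)) ((hc.smooth 0).mono hsub)
      (i := 0) (j := 4) (k := 3) (Or.inl rfl) (fun z hz => (hs z hz).2.1) (fun z hz => (hs z hz).1)
    have hX := hcl.pd_eq_zero hVo (fun z hz => hD z (hsub hz)) ((hc.smooth 1).mono hsub)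
      (i := 1) (j := 3) (k := 4) (Or.inr rfl) (fun z hz => (hs z hz).2.2.2)
      (fun z hz => (hs z hz).2.2.1)
    refine ⟨?_, fun z hz => ⟨(hT z hz).2.1, (hX z hz).2.1⟩,
      Or.inr fun z hz => ⟨(hT z hz).1, (hX z hz).1⟩⟩
    rintro z hz k (rfl | rfl)
    exacts [⟨(hs z hz).2.1, (hX z hz).2.2⟩, ⟨(hT z hz).2.2, (hs z hz).2.2.2⟩]

lemma IsContactAdmissible.pd_fibre (h : IsContactAdmissible f D Φ Ω f' D') {q : J1}
    (hq : q ∈ Ω) {k : Fin 5} (hk : k = 3 ∨ k = 4) :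
    pd k (fun z => Φ z 0) q = 0 ∧ pd k (fun z => Φ z 1) q = 0 ∧ pd k (fun z => Φ z 2) q = 0 := by
  obtain ⟨V, -, hqV, -, hV, -⟩ := h.exists_nhd hq
  obtain ⟨a, b⟩ := hV q hqV k hk
  refine ⟨a, b, ?_⟩
  have : contactCoeff Φ k q = 0 := by
    rcases hk with rfl | rfl
    exacts [(h.2.2.1.contactCoeff_eq hq).2.2.1, (h.2.2.1.contactCoeff_eq hq).2.2.2]
  simpa [contactCoeff, a, b] using this

end Admissible

/-! ### Prolongations of point transformations -/

lemma proj_prolong₁ (φ : J0 → J0) (q : J1) : proj (prolong₁ φ q) = φ (proj q) := by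
  ext i; fin_cases i <;> rfl

lemma totalDt_congr {g h : J1 → ℝ} {O : Set J1} (hO : IsOpen O) (e : EqOn g h O) {θ : J2}
    (hθ : θ.base ∈ O) : totalDt g θ = totalDt h θ := by
  simp only [totalDt, fun i => pd_eqOn (i := i) hO e hθ]

lemma totalDx_congr {g h : J1 → ℝ} {O : Set J1} (hO : IsOpen O) (e : EqOn g h O) {θ : J2}
    (hθ : θ.base ∈ O) : totalDx g θ = totalDx h θ := by
  simp only [totalDx, fun i => pd_eqOn (i := i) hO e hθ]

lemma totalDt_add {g h : J1 → ℝ} {θ : J2} (hg : DifferentiableAt ℝ g θ.base)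
    (hh : DifferentiableAt ℝ h θ.base) :
    totalDt (fun z => g z + h z) θ = totalDt g θ + totalDt h θ := by
  simp only [totalDt, fun i => pd_add i hg hh]; ring

lemma totalDx_add {g h : J1 → ℝ} {θ : J2} (hg : DifferentiableAt ℝ g θ.base)
    (hh : DifferentiableAt ℝ h θ.base) :
    totalDx (fun z => g z + h z) θ = totalDx g θ + totalDx h θ := by
  simp only [totalDx, fun i => pd_add i hg hh]; ring

lemma totalDt_mul {g h : J1 → ℝ} {θ : J2} (hg : DifferentiableAt ℝ g θ.base)
    (hh : DifferentiableAt ℝ h θ.base) :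
    totalDt (fun z => g z * h z) θ = totalDt g θ * h θ.base + g θ.base * totalDt h θ := by
  simp only [totalDt, fun i => pd_mul i hg hh]; ring

lemma totalDx_mul {g h : J1 → ℝ} {θ : J2} (hg : DifferentiableAt ℝ g θ.base)
    (hh : DifferentiableAt ℝ h θ.base) :
    totalDx (fun z => g z * h z) θ = totalDx g θ * h θ.base + g θ.base * totalDx h θ := by
  simp only [totalDx, fun i => pd_mul i hg hh]; ring

lemma totalDt_comp_proj {g : J0 → ℝ} {θ : J2} (hg : DifferentiableAt ℝ g (proj θ.base)) :
    totalDt (fun z => g (proj z)) θ = totalDt₀ g θ.base := by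
  have h0 : pd 0 (fun z => g (proj z)) θ.base = _ := pd_comp_proj 0 hg
  have h2 : pd 2 (fun z => g (proj z)) θ.base = _ := pd_comp_proj 2 hg
  rw [totalDt, totalDt₀, h0, h2, pd_comp_proj_fibre (.inl rfl) hg,
    pd_comp_proj_fibre (.inr rfl) hg]
  ring

lemma totalDx_comp_proj {g : J0 → ℝ} {θ : J2} (hg : DifferentiableAt ℝ g (proj θ.base)) :
    totalDx (fun z => g (proj z)) θ = totalDx₀ g θ.base := by
  have h1 : pd 1 (fun z => g (proj z)) θ.base = _ := pd_comp_proj 1 hg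
  have h2 : pd 2 (fun z => g (proj z)) θ.base = _ := pd_comp_proj 2 hg
  rw [totalDx, totalDx₀, h1, h2, pd_comp_proj_fibre (.inl rfl) hg,
    pd_comp_proj_fibre (.inr rfl) hg]
  ring

lemma differentiableAt_comp_proj {g : J0 → ℝ} {q : J1} (hg : DifferentiableAt ℝ g (proj q)) :
    DifferentiableAt ℝ (fun z => g (proj z)) q :=
  hg.comp q (proj_contDiff.differentiable (by simp) q)

lemma proj_continuous : Continuous proj := proj_contDiff.continuous

section Point
variable {φ : J0 → J0} {W : Set J0}

lemma totalDt₀_smooth {g : J0 → ℝ} (hW : IsOpen W) (hg : ContDiffOn ℝ ∞ g W) :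
    ContDiffOn ℝ ∞ (totalDt₀ g) (proj ⁻¹' W) := by
  have h := fun i => smooth_comp_proj (pd_contDiffOn i hW hg) (V := proj ⁻¹' W) fun _ hq => hq
  have hc : ContDiffOn ℝ ∞ (fun z : J1 => z 3) (proj ⁻¹' W) := by fun_prop
  exact (h 0).add (hc.mul (h 2))

lemma totalDx₀_smooth {g : J0 → ℝ} (hW : IsOpen W) (hg : ContDiffOn ℝ ∞ g W) :
    ContDiffOn ℝ ∞ (totalDx₀ g) (proj ⁻¹' W) := by
  have h := fun i => smooth_comp_proj (pd_contDiffOn i hW hg) (V := proj ⁻¹' W) fun _ hq => hq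
  have hc : ContDiffOn ℝ ∞ (fun z : J1 => z 4) (proj ⁻¹' W) := by fun_prop
  exact (h 1).add (hc.mul (h 2))

lemma det₁_smooth (hW : IsOpen W) (hφ : ∀ i, ContDiffOn ℝ ∞ (fun y => φ y i) W) :
    ContDiffOn ℝ ∞ (det₁ φ) (proj ⁻¹' W) :=
  ((totalDt₀_smooth hW (hφ 0)).mul (totalDx₀_smooth hW (hφ 1))).sub
    ((totalDx₀_smooth hW (hφ 0)).mul (totalDt₀_smooth hW (hφ 1)))

lemma prolongDomain_isOpen (hW : IsOpen W) (hφ : ∀ i, ContDiffOn ℝ ∞ (fun y => φ y i) W) :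
    IsOpen (prolongDomain φ W) :=
  (det₁_smooth hW hφ).continuousOn.isOpen_inter_preimage (hW.preimage proj_continuous)
    isOpen_compl_singleton

lemma prolong₁_three_differentiableAt (hW : IsOpen W)
    (hφ : ∀ i, ContDiffOn ℝ ∞ (fun y => φ y i) W) {q : J1} (hq : q ∈ prolongDomain φ W) :
    DifferentiableAt ℝ (fun z => prolong₁ φ z 3) q := by
  have hO := hW.preimage proj_continuous
  have d := fun {g : J1 → ℝ} (hg : ContDiffOn ℝ ∞ g (proj ⁻¹' W)) =>
    diffAt_of_contDiffOn hO hg hq.1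
  have hn := ((d (totalDt₀_smooth hW (hφ 2))).fun_mul (d (totalDx₀_smooth hW (hφ 1)))).fun_sub
    ((d (totalDx₀_smooth hW (hφ 2))).fun_mul (d (totalDt₀_smooth hW (hφ 1))))
  simp only [prolong₁, Matrix.cons_val, div_eq_mul_inv]
  exact hn.fun_mul ((d (det₁_smooth hW hφ)).fun_inv hq.2)

lemma det₂_prolong₁ (hW : IsOpen W) (hφ : ∀ i, ContDiffOn ℝ ∞ (fun y => φ y i) W) {θ : J2}
    (hθ : proj θ.base ∈ W) : det₂ (prolong₁ φ) θ = det₁ φ θ.base := by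
  have d := fun i => diffAt_of_contDiffOn hW (hφ i) hθ
  have hd : det₂ (prolong₁ φ) θ = totalDt (fun q => φ (proj q) 0) θ
      * totalDx (fun q => φ (proj q) 1) θ
    - totalDx (fun q => φ (proj q) 0) θ * totalDt (fun q => φ (proj q) 1) θ := rfl
  rw [hd, totalDt_comp_proj (d 0), totalDx_comp_proj (d 0), totalDt_comp_proj (d 1),
    totalDx_comp_proj (d 1), det₁]

/-- The derivative of `U_t + u_t U_u` in the direction of `x`, which is also the derivative of
`U_x + u_x U_u` in the direction of `t`. -/
noncomputable def mixedDeriv (U : J0 → ℝ) (θ : J2) : ℝ :=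
  pd 1 (pd 0 U) (proj θ.base) + θ.base 4 * pd 2 (pd 0 U) (proj θ.base)
    + θ.base 3 * pd 1 (pd 2 U) (proj θ.base)
    + θ.base 3 * θ.base 4 * pd 2 (pd 2 U) (proj θ.base) + θ.tx * pd 2 U (proj θ.base)

lemma totalDx_totalDt₀ {U : J0 → ℝ} (hW : IsOpen W) (hU : ContDiffOn ℝ ∞ U W) {θ : J2}
    (hθ : proj θ.base ∈ W) : totalDx (totalDt₀ U) θ = mixedDeriv U θ := by
  have d := fun i => diffAt_of_contDiffOn hW (pd_contDiffOn i hW hU) hθ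
  have d' := fun i => differentiableAt_comp_proj (d i)
  have dc : DifferentiableAt ℝ (fun z : J1 => z 3) θ.base := by fun_prop
  have e : totalDx (fun z : J1 => z 3) θ = θ.tx := by simp [totalDx, pd_coord]
  unfold totalDt₀
  rw [totalDx_add (d' 0) (dc.fun_mul (d' 2)), totalDx_mul dc (d' 2), totalDx_comp_proj (d 0),
    totalDx_comp_proj (d 2), e]
  simp only [totalDx₀, mixedDeriv]; ring

lemma totalDt_totalDx₀ {U : J0 → ℝ} (hW : IsOpen W) (hU : ContDiffOn ℝ ∞ U W) {θ : J2}
    (hθ : proj θ.base ∈ W) : totalDt (totalDx₀ U) θ = mixedDeriv U θ := by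
  have d := fun i => diffAt_of_contDiffOn hW (pd_contDiffOn i hW hU) hθ
  have d' := fun i => differentiableAt_comp_proj (d i)
  have dc : DifferentiableAt ℝ (fun z : J1 => z 4) θ.base := by fun_prop
  have e : totalDt (fun z : J1 => z 4) θ = θ.tx := by simp [totalDt, pd_coord]
  unfold totalDx₀
  rw [totalDt_add (d' 1) (dc.fun_mul (d' 2)), totalDt_mul dc (d' 2), totalDt_comp_proj (d 1),
    totalDt_comp_proj (d 2), e]
  simp only [totalDt₀, mixedDeriv]
  rw [pd_comm 0 1 hW hU hθ, pd_comm 2 1 hW hU hθ, pd_comm 0 2 hW hU hθ]; ring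

/-- For `T = T(t)`, `X = X(x)` or `T = T(x)`, `X = X(t)` the new mixed derivative is, up to a
factor depending on `(t, x)` only, a polynomial in `(u_t, u_x)`. -/
lemma prolong₂_prolong₁_tx (hW : IsOpen W) (hφ : ∀ i, ContDiffOn ℝ ∞ (fun y => φ y i) W)
    (hu : ∀ y ∈ W, pd 2 (fun y => φ y 0) y = 0 ∧ pd 2 (fun y => φ y 1) y = 0)
    (hs : (∀ y ∈ W, pd 1 (fun y => φ y 0) y = 0 ∧ pd 0 (fun y => φ y 1) y = 0) ∨
      (∀ y ∈ W, pd 0 (fun y => φ y 0) y = 0 ∧ pd 1 (fun y => φ y 1) y = 0))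
    {θ : J2} (hθ : θ.base ∈ prolongDomain φ W) :
    pd 0 (fun y => φ y 0) (proj θ.base) * pd 1 (fun y => φ y 1) (proj θ.base)
      + pd 1 (fun y => φ y 0) (proj θ.base) * pd 0 (fun y => φ y 1) (proj θ.base) ≠ 0 ∧
    (prolong₂ (prolong₁ φ) θ).tx
      * (pd 0 (fun y => φ y 0) (proj θ.base) * pd 1 (fun y => φ y 1) (proj θ.base)
      + pd 1 (fun y => φ y 0) (proj θ.base) * pd 0 (fun y => φ y 1) (proj θ.base))
      = mixedDeriv (fun y => φ y 2) θ := by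
  have hy := hθ.1
  have hO := prolongDomain_isOpen hW hφ
  have d := fun i => diffAt_of_contDiffOn hW (hφ i) hy
  have hdet := det₂_prolong₁ hW hφ hy
  have d3 := prolong₁_three_differentiableAt hW hφ hθ
  have htx : (prolong₂ (prolong₁ φ) θ).tx * det₁ φ θ.base
      = totalDt₀ (fun y => φ y 0) θ.base * totalDx (fun q => prolong₁ φ q 3) θ
        - totalDx₀ (fun y => φ y 0) θ.base * totalDt (fun q => prolong₁ φ q 3) θ := by
    have : (prolong₂ (prolong₁ φ) θ).tx = (totalDt (fun q => φ (proj q) 0) θ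
      * totalDx (fun q => prolong₁ φ q 3) θ - totalDx (fun q => φ (proj q) 0) θ
      * totalDt (fun q => prolong₁ φ q 3) θ) / det₂ (prolong₁ φ) θ := rfl
    rw [this, hdet, div_mul_cancel₀ _ hθ.2, totalDt_comp_proj (d 0), totalDx_comp_proj (d 0)]
  rcases hs with hs | hs
  · have hT : ∀ q : J1, proj q ∈ W → totalDt₀ (fun y => φ y 0) q = pd 0 (fun y => φ y 0) (proj q) ∧
        totalDx₀ (fun y => φ y 0) q = 0 ∧ totalDt₀ (fun y => φ y 1) q = 0 ∧
        totalDx₀ (fun y => φ y 1) q = pd 1 (fun y => φ y 1) (proj q) := fun q hq => by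
      simp [totalDt₀, totalDx₀, hu _ hq, hs _ hq]
    have hd1 : ∀ q : J1, proj q ∈ W → det₁ φ q
        = pd 0 (fun y => φ y 0) (proj q) * pd 1 (fun y => φ y 1) (proj q) := fun q hq => by
      simp [det₁, hT q hq]
    have hP : EqOn (fun z => prolong₁ φ z 3 * pd 0 (fun y => φ y 0) (proj z))
        (totalDt₀ (fun y => φ y 2)) (prolongDomain φ W) := by
      intro z hz
      have hne := hz.2
      rw [hd1 z hz.1] at hne
      have h0 := left_ne_zero_of_mul hne
      have h1 := right_ne_zero_of_mul hne
      simp only [prolong₁, Matrix.cons_val, hT z hz.1, hd1 z hz.1]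
      field_simp; ring
    have dT := diffAt_of_contDiffOn hW (pd_contDiffOn 0 hW (hφ 0)) hy
    have e := totalDx_congr hO hP hθ
    have hz : totalDx₀ (pd 0 fun y => φ y 0) θ.base = 0 := by
      rw [totalDx₀, pd_comm 1 0 hW (hφ 0) hy, pd_comm 2 0 hW (hφ 0) hy,
        pd_eq_zero hW (fun y hy => (hs y hy).1) hy, pd_eq_zero hW (fun y hy => (hu y hy).1) hy]
      ring
    rw [totalDx_mul d3 (differentiableAt_comp_proj dT), totalDx_comp_proj dT, hz,
      totalDx_totalDt₀ hW (hφ 2) hy] at e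
    have hne := hθ.2
    rw [hd1 _ hy] at hne htx
    simp only [hT _ hy] at htx
    rw [(hs _ hy).1, zero_mul, add_zero]
    refine ⟨hne, ?_⟩
    linear_combination htx + e
  · have hT : ∀ q : J1, proj q ∈ W → totalDx₀ (fun y => φ y 0) q = pd 1 (fun y => φ y 0) (proj q) ∧
        totalDt₀ (fun y => φ y 0) q = 0 ∧ totalDx₀ (fun y => φ y 1) q = 0 ∧
        totalDt₀ (fun y => φ y 1) q = pd 0 (fun y => φ y 1) (proj q) := fun q hq => by
      simp [totalDt₀, totalDx₀, hu _ hq, hs _ hq]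
    have hd1 : ∀ q : J1, proj q ∈ W → det₁ φ q
        = -(pd 1 (fun y => φ y 0) (proj q) * pd 0 (fun y => φ y 1) (proj q)) := fun q hq => by
      simp [det₁, hT q hq]
    have hP : EqOn (fun z => prolong₁ φ z 3 * pd 1 (fun y => φ y 0) (proj z))
        (totalDx₀ (fun y => φ y 2)) (prolongDomain φ W) := by
      intro z hz
      have hne := hz.2
      rw [hd1 z hz.1, neg_ne_zero] at hne
      have h0 := left_ne_zero_of_mul hne
      have h1 := right_ne_zero_of_mul hne
      simp only [prolong₁, Matrix.cons_val, hT z hz.1, hd1 z hz.1]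
      field_simp; ring
    have dT := diffAt_of_contDiffOn hW (pd_contDiffOn 1 hW (hφ 0)) hy
    have e := totalDt_congr hO hP hθ
    have hz : totalDt₀ (pd 1 fun y => φ y 0) θ.base = 0 := by
      rw [totalDt₀, pd_comm 0 1 hW (hφ 0) hy, pd_comm 2 1 hW (hφ 0) hy,
        pd_eq_zero hW (fun y hy => (hs y hy).1) hy, pd_eq_zero hW (fun y hy => (hu y hy).1) hy]
      ring
    rw [totalDt_mul d3 (differentiableAt_comp_proj dT), totalDt_comp_proj dT, hz,
      totalDt_totalDx₀ hW (hφ 2) hy] at e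
    have hne := hθ.2
    rw [hd1 _ hy] at hne htx
    rw [neg_ne_zero] at hne
    simp only [hT _ hy] at htx
    rw [(hs _ hy).1, zero_mul, zero_add]
    refine ⟨hne, ?_⟩
    linear_combination -htx + e

end Point

/-! ### Descent to the space of `(t, x, u)` -/

/-- Locally a fibre of the projection is convex, so functions with vanishing fibre derivatives are
locally constant along fibres. -/
lemma eq_of_isPreconnected_fibre {Ω : Set J1} (hΩ : IsOpen Ω) {g : J1 → ℝ}
    (hg : ContDiffOn ℝ ∞ g Ω) (hz : ∀ q ∈ Ω, ∀ k : Fin 5, k = 3 ∨ k = 4 → pd k g q = 0)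
    (hpre : ∀ y : J0, IsPreconnected {q | q ∈ Ω ∧ proj q = y}) {q q' : J1} (hq : q ∈ Ω)
    (hq' : q' ∈ Ω) (h : proj q = proj q') : g q = g q' := by
  refine (hpre (proj q')).induction₂' (fun a b => g a = g b) ?_
    (fun a b c _ _ _ hab hbc => hab.trans hbc) ⟨hq, h⟩ ⟨hq', rfl⟩
  rintro a ⟨ha, hay⟩
  obtain ⟨ε, hε, hball⟩ := Metric.isOpen_iff.1 hΩ a ha
  filter_upwards [mem_nhdsWithin_of_mem_nhds (Metric.ball_mem_nhds a hε), self_mem_nhdsWithin]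
    with b hb hby
  obtain ⟨c, hc, hgc⟩ := domain_mvt (f := g) (f' := fun z => fderiv ℝ g z)
    (s := Metric.ball a ε) (fun z hz =>
      (diffAt_of_contDiffOn hΩ hg (hball hz)).hasFDerivAt.hasFDerivWithinAt)
    (convex_ball a ε) (Metric.mem_ball_self hε) hb
  have hcΩ : c ∈ Ω :=
    hball ((convex_ball a ε).segment_subset (Metric.mem_ball_self hε) hb hc)
  have hpr : proj b = proj a := hby.2.trans hay.symm
  have p0 : b 0 = a 0 := congrFun hpr 0
  have p1 : b 1 = a 1 := congrFun hpr 1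
  have p2 : b 2 = a 2 := congrFun hpr 2
  rw [fderiv_eq_sum_pd, Fin.sum_univ_five, hz c hcΩ 3 (.inl rfl), hz c hcΩ 4 (.inr rfl)] at hgc
  simp only [Pi.sub_apply, p0, p1, p2] at hgc
  have : g b = g a := by linarith
  exact ⟨this.symm, this⟩

section Descent
variable {f f' : J0 → ℝ} {D D' : Set J0} {Φ : J1 → J1} {Ω : Set J1} {φ : J0 → J0}

lemma contDiffAt_of_descent (hΩ : IsOpen Ω) (hΦ : ContDiffOn ℝ ∞ Φ Ω)
    (hφ : ∀ q ∈ Ω, ∀ i : Fin 3, φ (proj q) i = Φ q (up i)) {q : J1} (hq : q ∈ Ω) :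
    ContDiffAt ℝ ∞ φ (proj q) := by
  -- a section of the projection through `q`
  set j : J0 → J1 := fun y => ![y 0, y 1, y 2, q 3, q 4] with hj
  have hjs : ContDiff ℝ ∞ j := by
    refine contDiff_pi.2 fun i => ?_
    fin_cases i <;> simp [hj] <;> fun_prop
  have hjq : j (proj q) = q := by ext i; fin_cases i <;> rfl
  have hpj : ∀ y, proj (j y) = y := fun y => by ext i; fin_cases i <;> rfl
  have hmem : j ⁻¹' Ω ∈ nhds (proj q) :=
    (hΩ.preimage hjs.continuous).mem_nhds (by rw [mem_preimage, hjq]; exact hq)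
  refine contDiffAt_pi.2 fun i => ?_
  have h1 : ContDiffAt ℝ ∞ (fun z => Φ z (up i)) (j (proj q)) := by
    rw [hjq]; exact (contDiffOn_pi.1 hΦ (up i)).contDiffAt (hΩ.mem_nhds hq)
  refine (h1.comp (proj q) hjs.contDiffAt).congr_of_eventuallyEq ?_
  filter_upwards [hmem] with y hy
  rw [Function.comp_apply, ← hφ _ hy, hpj]

lemma pd_descent (hΩ : IsOpen Ω) (hΦ : ContDiffOn ℝ ∞ Φ Ω)
    (hφ : ∀ q ∈ Ω, ∀ i : Fin 3, φ (proj q) i = Φ q (up i)) {q : J1} (hq : q ∈ Ω) (i k : Fin 3) :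
    pd i (fun y => φ y k) (proj q) = pd (up i) (fun z => Φ z (up k)) q := by
  have hd : DifferentiableAt ℝ (fun y => φ y k) (proj q) :=
    (contDiffAt_pi.1 (contDiffAt_of_descent hΩ hΦ hφ hq) k).differentiableAt (by simp)
  rw [← pd_comp_proj i hd]
  exact pd_eqOn hΩ (fun z hz => hφ z hz k) hq

lemma IsContactAdmissible.isPointTransformation (h : IsContactAdmissible f D Φ Ω f' D')
    (hφ : ∀ q ∈ Ω, ∀ i : Fin 3, φ (proj q) i = Φ q (up i)) :
    IsPointTransformation φ (proj '' Ω) := by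
  have hc := h.2.2.1
  refine ⟨proj_isOpenMap _ hc.1, ?_, ?_⟩
  · rintro _ ⟨q, hq, rfl⟩
    exact (contDiffAt_of_descent hc.1 hc.2.1 hφ hq).contDiffWithinAt
  · rintro _ ⟨q, hq, rfl⟩
    have hd : DifferentiableAt ℝ φ (proj q) :=
      (contDiffAt_of_descent hc.1 hc.2.1 hφ hq).differentiableAt (by simp)
    have hdi : ∀ k, DifferentiableAt ℝ (fun y => φ y k) (proj q) := differentiableAt_pi.1 hd
    have hsurj : Function.Surjective (fderiv ℝ Φ q : J1 →ₗ[ℝ] J1) :=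
      ((Module.End.isUnit_iff _).1 (LinearMap.isUnit_iff_isUnit_det _ |>.2
        (isUnit_iff_ne_zero.2 (hc.2.2.1 q hq)))).surjective
    have hcompat : ∀ v : J1, fderiv ℝ φ (proj q) (proj v) = proj (fderiv ℝ Φ q v) := by
      intro v
      have key : ∀ k : Fin 3, fderiv ℝ φ (proj q) (proj v) k = fderiv ℝ Φ q v (up k) := by
        intro k
        rw [fderiv_pi hdi, fderiv_pi fun i => hc.diffAt i hq]
        change fderiv ℝ (fun y => φ y k) (proj q) (proj v)
          = fderiv ℝ (fun z => Φ z (up k)) q v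
        have hz : ∀ m : Fin 5, m = 3 ∨ m = 4 → pd m (fun z => Φ z (up k)) q = 0 := by
          intro m hm
          obtain ⟨a, b, c⟩ := h.pd_fibre hq hm
          fin_cases k
          exacts [a, b, c]
        rw [fderiv_eq_sum_pd, fderiv_eq_sum_pd, Fin.sum_univ_five, Fin.sum_univ_three,
          hz 3 (.inl rfl), hz 4 (.inr rfl), pd_descent hc.1 hc.2.1 hφ hq,
          pd_descent hc.1 hc.2.1 hφ hq, pd_descent hc.1 hc.2.1 hφ hq]
        simp [proj, up]
      ext k; rw [key]; fin_cases k <;> rfl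
    have hs0 : Function.Surjective (fderiv ℝ φ (proj q) : J0 →ₗ[ℝ] J0) := by
      intro y
      obtain ⟨v, hv⟩ := hsurj ![y 0, y 1, y 2, 0, 0]
      refine ⟨proj v, ?_⟩
      rw [ContinuousLinearMap.coe_coe, hcompat]
      rw [ContinuousLinearMap.coe_coe] at hv
      rw [hv]; ext i; fin_cases i <;> rfl
    exact (LinearMap.isUnit_iff_isUnit_det _ |>.1 ((Module.End.isUnit_iff _).2
      ⟨LinearMap.injective_iff_surjective.2 hs0, hs0⟩)).ne_zero

lemma IsContactAdmissible.totalD_descent (h : IsContactAdmissible f D Φ Ω f' D')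
    (hφ : ∀ q ∈ Ω, ∀ i : Fin 3, φ (proj q) i = Φ q (up i)) {q : J1} (hq : q ∈ Ω) (k : Fin 3) :
    (∀ s, jetDeriv s (fun z => Φ z (up k)) q
      = ![totalDt₀ (fun y => φ y k) q, totalDx₀ (fun y => φ y k) q, 0, 0]) := by
  intro s
  have hc := h.2.2.1
  have hz : ∀ m : Fin 5, m = 3 ∨ m = 4 → pd m (fun z => Φ z (up k)) q = 0 := by
    intro m hm
    obtain ⟨a, b, c⟩ := h.pd_fibre hq hm
    fin_cases k
    exacts [a, b, c]
  have p : ∀ i, pd i (fun y => φ y k) (proj q) = _ := fun i => pd_descent hc.1 hc.2.1 hφ hq i k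
  rw [jetDeriv, hz 3 (.inl rfl), hz 4 (.inr rfl), totalDt₀, totalDx₀, p, p, p]
  simp [up]

lemma IsContactAdmissible.eq_prolong₁ (h : IsContactAdmissible f D Φ Ω f' D')
    (hφ : ∀ q ∈ Ω, ∀ i : Fin 3, φ (proj q) i = Φ q (up i)) {q : J1} (hq : q ∈ Ω) :
    det₁ φ q ≠ 0 ∧ Φ q = prolong₁ φ q := by
  have hc := h.2.2.1
  have hT : jetDeriv 0 (fun z => Φ z 0) q = _ := h.totalD_descent hφ hq 0 0
  have hX : jetDeriv 0 (fun z => Φ z 1) q = _ := h.totalD_descent hφ hq 1 0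
  have hU : jetDeriv 0 (fun z => Φ z 2) q = _ := h.totalD_descent hφ hq 2 0
  have hdet : det₁ φ q ≠ 0 := by
    intro hd
    rw [det₁] at hd
    refine (hc.confSympl 0 hq).det_ne (hc.contactCoeff_ne_zero hq) ?_ ?_ ?_ ?_ <;>
      rw [hT, hX] <;> simp only [Matrix.cons_val]
    · exact hd
    all_goals ring
  refine ⟨hdet, ?_⟩
  obtain ⟨et, ex⟩ := hc.2.2.2 ⟨q, 0, 0, 0⟩ hq
  simp only [totalDt_eq, totalDx_eq, hT, hX, hU, Matrix.cons_val] at et ex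
  have e3 : Φ q 3 = prolong₁ φ q 3 := by
    simp only [prolong₁, Matrix.cons_val]
    rw [eq_div_iff hdet, det₁]
    linear_combination totalDx₀ (fun y => φ y 1) q * et - totalDt₀ (fun y => φ y 1) q * ex
  have e4 : Φ q 4 = prolong₁ φ q 4 := by
    simp only [prolong₁, Matrix.cons_val]
    rw [eq_div_iff hdet, det₁]
    linear_combination totalDt₀ (fun y => φ y 0) q * ex - totalDx₀ (fun y => φ y 0) q * et
  ext i
  fin_cases i
  exacts [(hφ q hq 0).symm, (hφ q hq 1).symm, (hφ q hq 2).symm, e3, e4]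

lemma prolong₂_congr {Ψ : J1 → J1} (hΩ : IsOpen Ω) (e : EqOn Φ Ψ Ω) {θ : J2}
    (hθ : θ.base ∈ Ω) : det₂ Φ θ = det₂ Ψ θ ∧ prolong₂ Φ θ = prolong₂ Ψ θ := by
  have t := fun i : Fin 5 => totalDt_congr (g := fun z => Φ z i) (h := fun z => Ψ z i) hΩ
    (fun z hz => congrFun (e hz) i) hθ
  have x := fun i : Fin 5 => totalDx_congr (g := fun z => Φ z i) (h := fun z => Ψ z i) hΩ
    (fun z hz => congrFun (e hz) i) hθ
  have hd : det₂ Φ θ = det₂ Ψ θ := by simp only [det₂, t, x]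
  refine ⟨hd, ?_⟩
  simp only [prolong₂, hd, t, x, e hθ]

lemma bilin_eq_zero_of_small {a b c d p q ε : ℝ} (hε : 0 < ε)
    (h : ∀ r s : ℝ, (r = 0 ∨ r = ε) → (s = 0 ∨ s = ε) →
      a + b * (q + s) + c * (p + r) + d * ((p + r) * (q + s)) = 0) (x y : ℝ) :
    a + b * y + c * x + d * (x * y) = 0 := by
  have h00 := h 0 0 (.inl rfl) (.inl rfl)
  have h10 := h ε 0 (.inr rfl) (.inl rfl)
  have h01 := h 0 ε (.inl rfl) (.inr rfl)
  have h11 := h ε ε (.inr rfl) (.inr rfl)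
  have hd : d = 0 := by
    apply mul_left_cancel₀ (mul_ne_zero hε.ne' hε.ne')
    linear_combination h11 - h10 - h01 + h00
  subst hd
  have hb : b = 0 := by apply mul_left_cancel₀ hε.ne'; linear_combination h01 - h00
  have hcc : c = 0 := by apply mul_left_cancel₀ hε.ne'; linear_combination h10 - h00
  subst hb hcc
  linear_combination h00

/-- The equation for the image holds on the whole domain of the prolongation, because it is
polynomial in `(u_t, u_x)` and holds on an open part of each fibre. -/
lemma IsContactAdmissible.mapsEquation (h : IsContactAdmissible f D Φ Ω f' D')
    (hφ : ∀ q ∈ Ω, ∀ i : Fin 3, φ (proj q) i = Φ q (up i)) :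
    MapsEquation f (prolong₁ φ) (prolongDomain φ (proj '' Ω)) f' := by
  have hc := h.2.2.1
  have hW := h.isPointTransformation hφ
  intro θ hθ _ hf
  obtain ⟨q, hq, hqθ⟩ := hθ.1
  obtain ⟨V, hV, hqV, hVΩ, -, hu, hs⟩ := h.exists_nhd hq
  have pdd := fun {z : J1} (hz : z ∈ V) => pd_descent hc.1 hc.2.1 hφ (hVΩ hz)
  have hWV : IsOpen (proj '' V) := proj_isOpenMap _ hV
  have hφV : ∀ i, ContDiffOn ℝ ∞ (fun y => φ y i) (proj '' V) := fun i =>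
    contDiffOn_pi.1 (hW.2.1.mono (image_mono hVΩ)) i
  have hu' : ∀ y ∈ proj '' V,
      pd 2 (fun y => φ y 0) y = 0 ∧ pd 2 (fun y => φ y 1) y = 0 := by
    rintro _ ⟨z, hz, rfl⟩
    rw [pdd hz, pdd hz]; exact hu z hz
  have hs' : (∀ y ∈ proj '' V, pd 1 (fun y => φ y 0) y = 0 ∧ pd 0 (fun y => φ y 1) y = 0) ∨
      (∀ y ∈ proj '' V, pd 0 (fun y => φ y 0) y = 0 ∧ pd 1 (fun y => φ y 1) y = 0) := by
    refine hs.imp ?_ ?_ <;>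
    · rintro hs _ ⟨z, hz, rfl⟩
      rw [pdd hz, pdd hz]; exact hs z hz
  have formula := fun {θ : J2} => prolong₂_prolong₁_tx hWV hφV hu' hs' (θ := θ)
  have hθV : θ.base ∈ prolongDomain φ (proj '' V) := ⟨⟨q, hqV, hqθ⟩, hθ.2⟩
  obtain ⟨hne, htx⟩ := formula hθV
  set c := pd 0 (fun y => φ y 0) (proj θ.base) * pd 1 (fun y => φ y 1) (proj θ.base)
      + pd 1 (fun y => φ y 0) (proj θ.base) * pd 0 (fun y => φ y 1) (proj θ.base) with hcdef
  -- the equation holds over `V`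
  have known : ∀ z ∈ V, proj z = proj θ.base →
      f' (φ (proj θ.base)) * c = mixedDeriv (fun y => φ y 2) ⟨z, 0, f (proj θ.base), 0⟩ := by
    intro z hz hzθ
    obtain ⟨hdet, -⟩ := h.eq_prolong₁ hφ (hVΩ hz)
    obtain ⟨c1, c2⟩ := prolong₂_congr (θ := ⟨z, 0, f (proj θ.base), 0⟩) hc.1
      (fun w hw => (h.eq_prolong₁ hφ hw).2) (hVΩ hz)
    have hd2 : det₂ (prolong₁ φ) ⟨z, 0, f (proj θ.base), 0⟩ = det₁ φ z :=
      det₂_prolong₁ hWV hφV (mem_image_of_mem _ hz)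
    have hm := h.2.2.2.2.2 ⟨z, 0, f (proj θ.base), 0⟩ (hVΩ hz) (by rw [c1, hd2]; exact hdet)
      (by simp [equationSet, hzθ])
    rw [c2] at hm
    have hm' : (prolong₂ (prolong₁ φ) ⟨z, 0, f (proj θ.base), 0⟩).tx
        = f' (proj (prolong₁ φ z)) := hm
    obtain ⟨-, ht⟩ := formula (θ := ⟨z, 0, f (proj θ.base), 0⟩)
      ⟨mem_image_of_mem _ hz, hdet⟩
    rw [hm', proj_prolong₁] at ht
    simp only [hzθ] at ht
    exact ht
  obtain ⟨ε, hε, hball⟩ := Metric.isOpen_iff.1 hV q hqV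
  have hf' : θ.tx = f (proj θ.base) := hf
  have hpoly : f' (φ (proj θ.base)) * c = mixedDeriv (fun y => φ y 2) θ := by
    simp only [mixedDeriv] at known ⊢
    rw [hf']
    have hz : ∀ r s : ℝ, (r = 0 ∨ r = ε / 2) → (s = 0 ∨ s = ε / 2) →
        (![q 0, q 1, q 2, q 3 + r, q 4 + s] : J1) ∈ V ∧
          proj ![q 0, q 1, q 2, q 3 + r, q 4 + s] = proj θ.base := by
      intro r s hr hs
      refine ⟨hball ?_, ?_⟩
      · rw [Metric.mem_ball, dist_pi_lt_iff hε]
        have ar : |r| < ε := by rcases hr with rfl | rfl <;> simp [abs_of_pos, hε]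
        have as : |s| < ε := by rcases hs with rfl | rfl <;> simp [abs_of_pos, hε]
        intro i
        fin_cases i <;> simp [hε, ar, as]
      · rw [← hqθ]; ext i; fin_cases i <;> rfl
    have := bilin_eq_zero_of_small (half_pos hε) (p := q 3) (q := q 4)
      (a := pd 1 (pd 0 fun y => φ y 2) (proj θ.base)
        + f (proj θ.base) * pd 2 (fun y => φ y 2) (proj θ.base) - f' (φ (proj θ.base)) * c)
      (b := pd 2 (pd 0 fun y => φ y 2) (proj θ.base))
      (c := pd 1 (pd 2 fun y => φ y 2) (proj θ.base))
      (d := pd 2 (pd 2 fun y => φ y 2) (proj θ.base)) (by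
        intro r s hr hs
        obtain ⟨z1, z2⟩ := hz r s hr hs
        have := known _ z1 z2
        rw [z2] at this
        simp only [Matrix.cons_val] at this
        linear_combination -this) (θ.base 3) (θ.base 4)
    linear_combination -this
  change (prolong₂ (prolong₁ φ) θ).tx = f' (proj (prolong₁ φ θ.base))
  rw [proj_prolong₁]
  exact mul_right_cancel₀ hne (htx.trans hpoly.symm)

lemma IsContactAdmissible.isProlongation (h : IsContactAdmissible f D Φ Ω f' D')
    (hpre : ∀ y : J0, IsPreconnected {q | q ∈ Ω ∧ proj q = y}) :
    IsProlongationOfPointAdmissible f D Φ Ω f' D' := by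
  have hc := h.2.2.1
  let φ : J0 → J0 := fun y i => Φ (Function.invFunOn proj Ω y) (up i)
  have hφ : ∀ q ∈ Ω, ∀ i : Fin 3, φ (proj q) i = Φ q (up i) := by
    intro q hq i
    have hex : ∃ a ∈ Ω, proj a = proj q := ⟨q, hq, rfl⟩
    refine eq_of_isPreconnected_fibre hc.1 (hc.smooth (up i)) ?_ hpre
      (Function.invFunOn_mem hex) hq (Function.invFunOn_eq hex)
    intro z hz k hk
    obtain ⟨a, b, c⟩ := h.pd_fibre hz hk
    fin_cases i
    exacts [a, b, c]
  refine ⟨φ, ⟨h.1, h.2.1, h.isPointTransformation hφ, ?_, ?_, h.mapsEquation hφ⟩,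
    fun q hq => h.eq_prolong₁ hφ hq⟩
  · rintro _ ⟨q, hq, rfl⟩
    exact h.2.2.2.1 q hq
  · rintro _ ⟨q, hq, rfl⟩
    have : φ (proj q) = proj (Φ q) := by
      ext i; rw [hφ q hq]; fin_cases i <;> rfl
    rw [this]; exact h.2.2.2.2.1 q hq

lemma IsContactAdmissible.mono (h : IsContactAdmissible f D Φ Ω f' D') {V : Set J1}
    (hV : IsOpen V) (hVΩ : V ⊆ Ω) : IsContactAdmissible f D Φ V f' D' := by
  obtain ⟨h1, h2, ⟨-, c2, c3, c4⟩, h4, h5, h6⟩ := h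
  exact ⟨h1, h2, ⟨hV, c2.mono hVΩ, fun q hq => c3 q (hVΩ hq), fun θ hθ => c4 θ (hVΩ hθ)⟩,
    fun q hq => h4 q (hVΩ hq), fun q hq => h5 q (hVΩ hq), fun θ hθ => h6 θ (hVΩ hθ)⟩

end Descent

theorem lemma1 (f f' : J0 → ℝ) (D D' : Set J0) (Φ : J1 → J1) (Ω : Set J1)
    (h : IsContactAdmissible f D Φ Ω f' D') :
    (∀ q ∈ Ω, ∃ V : Set J1, IsOpen V ∧ q ∈ V ∧ V ⊆ Ω ∧
      IsProlongationOfPointAdmissible f D Φ V f' D') ∧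
    ((∀ y : J0, IsPreconnected {q | q ∈ Ω ∧ proj q = y}) →
      IsProlongationOfPointAdmissible f D Φ Ω f' D') := by
  refine ⟨fun q hq => ?_, h.isProlongation⟩
  obtain ⟨ε, hε, hball⟩ := Metric.isOpen_iff.1 h.2.2.1.1 q hq
  refine ⟨Metric.ball q ε, Metric.isOpen_ball, Metric.mem_ball_self hε, hball,
    (h.mono Metric.isOpen_ball hball).isProlongation fun y => ?_⟩
  -- the fibres of a ball are convex
  have : {z : J1 | z ∈ Metric.ball q ε ∧ proj z = y} = Metric.ball q ε ∩ projL ⁻¹' {y} := by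
    ext z; simp [projL_apply]
  rw [this]
  exact ((convex_ball q ε).inter
    ((convex_singleton y).is_linear_preimage projL.isBoundedLinearMap.toIsLinearMap)).isPreconnected
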